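/- Let $e\ge 2$ and $r\ge 2$ be integers. Let $\mathbf{B}^\oplus(e,e,r)$ be the monoid with generators $t_i$ ($i\in\mathbb{Z}/e$) and $s_3,\dots,s_r$, subject to the relations - $s_is_js_i=s_js_is_j$ for $|i-j|=1$, - $s_is_j=s_js_i$ for $|i-j|>1$, - $s_3t_is_3=t_is_3t_i$ for $i\in\mathbb{Z}/e$, - $s_jt_i=t_is_j$ for $i\in\mathbb{Z}/e$ and $4\le j\le r$, - $t_it_{i-1}=t_jt_{j-1}$ for $i,j\in\mathbb{Z}/e$. These relations preserve the length of words, so every element has a well-defined length. A *Garside element* of a monoid is an element whose left and right divisors coincide, are finite in number and generate the monoid; the *minimal* Garside element is the one that left-divides every Garside element, and its divisors are the *simples* of the monoid. Then $\mathbf{B}^\oplus(e,e,r)$ has a unique minimal Garside element, so its set of simples is finite, and with $a_n$ the number of simples of length $n$, the polynomial $P^\oplus_{(e,e,r)}(q)=\sum_n a_nq^n$ satisfies $$P^\oplus_{(e,e,r)}(q)=\prod_{k=2}^r\bigl(1+q+\cdots+q^{k-2}+e\,q^{k-1}+q^k+\cdots+q^{2k-2}\bigr).$$ -/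

import Mathlib

open Polynomial

namespace CorranPicantin

/-! ### Garside elements and simples of a monoid

In a monoid, Mathlib's `a ∣ b` means `∃ c, b = a * c`, so it is left divisibility. -/

/-- `x` right-divides `y`: there is `z` with `y = z * x`. -/
def RightDvd {M : Type*} [Monoid M] (x y : M) : Prop := ∃ z, y = z * x

/-- A Garside element: its left and right divisors coincide, are finite in number, and generate
the monoid. -/
structure IsGarsideElement {M : Type*} [Monoid M] (Δ : M) : Prop where
  balanced : ∀ x : M, x ∣ Δ ↔ RightDvd x Δ
  finite_divisors : {x : M | x ∣ Δ}.Finite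
  generates : Submonoid.closure {x : M | x ∣ Δ} = ⊤

/-- The minimal Garside element: a Garside element that divides every Garside element. -/
structure IsMinimalGarsideElement {M : Type*} [Monoid M] (Δ : M) : Prop where
  isGarsideElement : IsGarsideElement Δ
  dvd : ∀ Δ' : M, IsGarsideElement Δ' → Δ ∣ Δ'

/-- The simples of a monoid: the divisors of its minimal Garside element. -/
def simples (M : Type*) [Monoid M] : Set M :=
  {x | ∃ Δ : M, IsMinimalGarsideElement Δ ∧ x ∣ Δ}

/-! ### The braid monoid of type `(e, e, r)` -/

/-- The generators: `t i` for `i ∈ ℤ/e`, and `s j` for `3 ≤ j ≤ r`. -/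
inductive Gen (e r : ℕ) : Type
  | t (i : ZMod e) : Gen e r
  | s (j : {j : ℕ // 3 ≤ j ∧ j ≤ r}) : Gen e r

/-- The generator `t i` as a word. -/
def tw {e : ℕ} (r : ℕ) (i : ZMod e) : FreeMonoid (Gen e r) := FreeMonoid.of (Gen.t i)

/-- The generator `s j` as a word. -/
def sw (e : ℕ) {r : ℕ} (j : {j : ℕ // 3 ≤ j ∧ j ≤ r}) : FreeMonoid (Gen e r) :=
  FreeMonoid.of (Gen.s j)

/-- The defining relations of the monoid. -/
inductive Rel (e r : ℕ) : FreeMonoid (Gen e r) → FreeMonoid (Gen e r) → Prop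
  | braid_s (i j : {j : ℕ // 3 ≤ j ∧ j ≤ r}) (h : |(i.1 : ℤ) - (j.1 : ℤ)| = 1) :
      Rel e r (sw e i * sw e j * sw e i) (sw e j * sw e i * sw e j)
  | comm_s (i j : {j : ℕ // 3 ≤ j ∧ j ≤ r}) (h : 1 < |(i.1 : ℤ) - (j.1 : ℤ)|) :
      Rel e r (sw e i * sw e j) (sw e j * sw e i)
  | braid_t (j : {j : ℕ // 3 ≤ j ∧ j ≤ r}) (h : j.1 = 3) (i : ZMod e) :
      Rel e r (sw e j * tw r i * sw e j) (tw r i * sw e j * tw r i)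
  | comm_t (j : {j : ℕ // 3 ≤ j ∧ j ≤ r}) (h : 4 ≤ j.1) (i : ZMod e) :
      Rel e r (sw e j * tw r i) (tw r i * sw e j)
  | circle (i j : ZMod e) :
      Rel e r (tw r i * tw r (i - 1)) (tw r j * tw r (j - 1))

/-- The braid monoid `B^⊕(e, e, r)`, given by generators and relations. -/
abbrev BraidMonoid (e r : ℕ) : Type := PresentedMonoid (Rel e r)

/-- The relations preserve the length of words. -/
theorem length_rel {e r : ℕ} (a b : FreeMonoid (Gen e r)) (h : Rel e r a b) :
    FreeMonoid.lift (fun _ : Gen e r => Multiplicative.ofAdd (1 : ℕ)) a =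
      FreeMonoid.lift (fun _ : Gen e r => Multiplicative.ofAdd (1 : ℕ)) b := by
  cases h <;> simp [sw, tw]

/-- The length of an element: the number of letters of any word in the generators that
represents it. -/
def length {e r : ℕ} (x : BraidMonoid e r) : ℕ :=
  Multiplicative.toAdd
    (PresentedMonoid.lift (fun _ : Gen e r => Multiplicative.ofAdd (1 : ℕ)) length_rel x)

/-- The number `a_n` of simples of length `n`. -/
noncomputable def numSimples (e r n : ℕ) : ℕ :=
  {x : BraidMonoid e r | x ∈ simples (BraidMonoid e r) ∧ length x = n}.ncard

/-- The generating polynomial `∑ a_n q^n` of the simples by length. -/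
noncomputable def simplePolynomial (e r : ℕ) : ℕ[X] :=
  ∑ᶠ n : ℕ, C (numSimples e r n) * X ^ n

end CorranPicantin

/-! The monoid is attacked through lcms of generators. Any two generators `a`, `b` have a right
common multiple given by the one relation between them. The key claim (`lcmProp`) is that every
equality `gen a * x = gen b * y` is a right multiple of that relation. It is proved by induction on
length; within a length, an equality is a chain of elementary moves, and two consecutive links merge
by the cube condition (`LcmProp.trans`). Left cancellation follows, as do rules that transfer
divisibility across a single letter.

Rank the generators along the diagram, all `t i` having rank 0. Every element factors uniquely as `x
* c`, with `x` in the parabolic submonoid of ranks below `m` and `c` divisible by no generator of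
rank below `m` (`decomposition_unique`). The candidate Garside element is `Delta m = lam 0 * ⋯ * lam
(m - 1)` for `m = r - 1`. Conjugation by `lam m` rotates the indices of the `t i` by one and fixes
the other generators of lower rank (`mul_lam`), so `Delta m` is quasi-central in its parabolic.
Since the lcm of `lam m` and the next generator is `lam m * lam (m + 1)` (`lam_succ_dvd`), `Delta m`
is the lcm of the generators of rank below `m` (`Delta_dvd`). Every Garside element is a multiple of
all generators, which gives minimality.

For the count, the divisors of `Delta (m + 1)` are exactly the products of a divisor of `Delta m`
and a left divisor of `lam m` (`exists_of_dvd_Delta_succ`, `mul_dvd_Delta_succ`), uniquely. The left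
divisors of `lam m` form a chain, except that the middle step branches into the `e` elements ending
in a `t i`. Their length polynomial is the factor of the product for `k = m + 2`. -/

namespace CorranPicantin

variable {e r : ℕ}

/-! ### Generators, ranks and induction on words -/

/-- The generator `a` as an element of the monoid. -/
def gen (a : Gen e r) : BraidMonoid e r := PresentedMonoid.of (Rel e r) a

/-- The element `t i`. -/
abbrev T (r : ℕ) {e : ℕ} (i : ZMod e) : BraidMonoid e r := gen (Gen.t i)

/-- The rank of a generator: `0` for each `t i` and `j - 2` for `s j`. -/
def Gen.rank : Gen e r → ℕ
  | .t _ => 0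
  | .s j => j.1 - 2

/-- The ranks of two generators are adjacent. -/
def Adj (j k : ℕ) : Prop := j + 1 = k ∨ k + 1 = j

/-- The ranks of two generators differ by at least two. -/
def Far (j k : ℕ) : Prop := j + 1 < k ∨ k + 1 < j

theorem Adj.symm {j k : ℕ} (h : Adj j k) : Adj k j := h.elim Or.inr Or.inl

theorem Far.symm {j k : ℕ} (h : Far j k) : Far k j := h.elim Or.inr Or.inl

@[simp] theorem rank_t (i : ZMod e) : (Gen.t i : Gen e r).rank = 0 := rfl

theorem eq_of_rank_eq {a b : Gen e r} (h : a.rank = b.rank) :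
    a = b ∨ ∃ i j, a = .t i ∧ b = .t j := by
  rcases a with i | ⟨j, hj⟩ <;> rcases b with i' | ⟨j', hj'⟩
  · exact Or.inr ⟨_, _, rfl, rfl⟩
  · simp only [Gen.rank] at h; omega
  · simp only [Gen.rank] at h; omega
  · left
    simp only [Gen.rank] at h
    have : j = j' := by omega
    subst this; rfl

theorem mk_eq_of_rel {u v : FreeMonoid (Gen e r)} (h : Rel e r u v) :
    PresentedMonoid.mk (Rel e r) u = PresentedMonoid.mk (Rel e r) v :=
  PresentedMonoid.mk_eq_mk_of_rel h

theorem circle (i j : ZMod e) : T r i * T r (i - 1) = T r j * T r (j - 1) :=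
  mk_eq_of_rel (Rel.circle i j)

theorem circle_assoc (i j : ZMod e) (x : BraidMonoid e r) :
    T r i * (T r (i - 1) * x) = T r j * (T r (j - 1) * x) := by
  rw [← mul_assoc, circle i j, mul_assoc]

theorem far_comm {a b : Gen e r} (h : Far a.rank b.rank) : gen a * gen b = gen b * gen a := by
  rcases a with i | ⟨j, hj⟩ <;> rcases b with i' | ⟨j', hj'⟩
  · simp only [Gen.rank, Far] at h; omega
  · simp only [Gen.rank, Far] at h
    exact (mk_eq_of_rel (Rel.comm_t _ (by simp only; omega) _)).symm
  · simp only [Gen.rank, Far] at h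
    exact mk_eq_of_rel (Rel.comm_t _ (by simp only; omega) _)
  · simp only [Gen.rank, Far] at h
    refine mk_eq_of_rel (Rel.comm_s _ _ ?_)
    simp only [lt_abs]; omega

theorem far_comm_assoc {a b : Gen e r} (h : Far a.rank b.rank) (x : BraidMonoid e r) :
    gen a * (gen b * x) = gen b * (gen a * x) := by
  rw [← mul_assoc, far_comm h, mul_assoc]

theorem adj_braid {a b : Gen e r} (h : Adj a.rank b.rank) :
    gen a * (gen b * gen a) = gen b * (gen a * gen b) := by
  rcases a with i | ⟨j, hj⟩ <;> rcases b with i' | ⟨j', hj'⟩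
  · simp only [Gen.rank, Adj] at h; omega
  · simp only [Gen.rank, Adj] at h
    have h3 : j' = 3 := by omega
    exact (mk_eq_of_rel (Rel.braid_t ⟨j', hj'⟩ h3 i)).symm
  · simp only [Gen.rank, Adj] at h
    have h3 : j = 3 := by omega
    exact mk_eq_of_rel (Rel.braid_t ⟨j, hj⟩ h3 i')
  · simp only [Gen.rank, Adj] at h
    refine mk_eq_of_rel (Rel.braid_s ⟨j, hj⟩ ⟨j', hj'⟩ ?_)
    rw [abs_eq (by norm_num)]; simp only; omega

theorem adj_braid_assoc {a b : Gen e r} (h : Adj a.rank b.rank) (x : BraidMonoid e r) :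
    gen a * (gen b * (gen a * x)) = gen b * (gen a * (gen b * x)) := by
  have := congrArg (· * x) (adj_braid h)
  simpa only [mul_assoc] using this

@[elab_as_elim]
theorem gen_induction {p : BraidMonoid e r → Prop} (one : p 1)
    (gen_mul : ∀ a x, p x → p (gen a * x)) (x : BraidMonoid e r) : p x := by
  induction x using PresentedMonoid.inductionOn with
  | _ w =>
    induction w using FreeMonoid.inductionOn' with
    | one => exact one
    | of_mul a w ih => exact gen_mul a _ ih

@[elab_as_elim]
theorem mul_gen_induction {p : BraidMonoid e r → Prop} (one : p 1)
    (mul_gen : ∀ x a, p x → p (x * gen a)) (x : BraidMonoid e r) : p x := by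
  suffices ∀ y, p y → p (y * x) by simpa using this 1 one
  induction x using gen_induction with
  | one => intro y hy; simpa using hy
  | gen_mul a x ih => intro y hy; rw [← mul_assoc]; exact ih _ (mul_gen _ _ hy)

@[simp] theorem length_one : length (1 : BraidMonoid e r) = 0 := by simp [length]

@[simp] theorem length_mul (x y : BraidMonoid e r) : length (x * y) = length x + length y := by
  simp [length]

@[simp] theorem length_gen (a : Gen e r) : length (gen a) = 1 := by
  simp [length, gen]

theorem eq_one_or_gen_mul (x : BraidMonoid e r) : x = 1 ∨ ∃ a y, x = gen a * y := by
  induction x using gen_induction with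
  | one => exact Or.inl rfl
  | gen_mul a x _ => exact Or.inr ⟨a, x, rfl⟩

theorem eq_one_of_length_eq_zero {x : BraidMonoid e r} (h : length x = 0) : x = 1 := by
  rcases eq_one_or_gen_mul x with rfl | ⟨a, y, rfl⟩
  · rfl
  · simp at h

theorem not_gen_dvd_one (a : Gen e r) : ¬ gen a ∣ (1 : BraidMonoid e r) := by
  rintro ⟨y, hy⟩
  have := congrArg length hy
  simp only [length_one, length_mul, length_gen] at this
  omega

/-! ### Least common multiples of generators -/

/-- `gen a * x = gen b * y` is a multiple of the relation between `a` and `b`. -/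
def IsLcmMul (a b : Gen e r) (x y : BraidMonoid e r) : Prop :=
  (a = b ∧ x = y) ∨
  (∃ i j z, i ≠ j ∧ a = .t i ∧ b = .t j ∧ x = T r (i - 1) * z ∧ y = T r (j - 1) * z) ∨
  (Adj a.rank b.rank ∧ ∃ z, x = gen b * (gen a * z) ∧ y = gen a * (gen b * z)) ∨
  (Far a.rank b.rank ∧ ∃ z, x = gen b * z ∧ y = gen a * z)

namespace IsLcmMul

variable {a b c : Gen e r} {x y w : BraidMonoid e r}

theorem of_eq (h : a = b) (h' : x = y) : IsLcmMul a b x y := Or.inl ⟨h, h'⟩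

theorem of_circle {i j : ZMod e} (h : i ≠ j) (z) (hx : x = T r (i - 1) * z)
    (hy : y = T r (j - 1) * z) : IsLcmMul (.t i) (.t j) x y :=
  Or.inr (Or.inl ⟨i, j, z, h, rfl, rfl, hx, hy⟩)

theorem of_adj (h : Adj a.rank b.rank) (z) (hx : x = gen b * (gen a * z))
    (hy : y = gen a * (gen b * z)) : IsLcmMul a b x y :=
  Or.inr (Or.inr (Or.inl ⟨h, z, hx, hy⟩))

theorem of_far (h : Far a.rank b.rank) (z) (hx : x = gen b * z)
    (hy : y = gen a * z) : IsLcmMul a b x y :=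
  Or.inr (Or.inr (Or.inr ⟨h, z, hx, hy⟩))

theorem symm (h : IsLcmMul a b x y) : IsLcmMul b a y x := by
  rcases h with ⟨rfl, rfl⟩ | ⟨i, j, z, hij, rfl, rfl, rfl, rfl⟩ | ⟨h, z, rfl, rfl⟩ | ⟨h, z, rfl, rfl⟩
  · exact of_eq rfl rfl
  · exact of_circle hij.symm z rfl rfl
  · exact of_adj h.symm z rfl rfl
  · exact of_far h.symm z rfl rfl

theorem mul_right (h : IsLcmMul a b x y) (w : BraidMonoid e r) :
    IsLcmMul a b (x * w) (y * w) := by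
  rcases h with ⟨rfl, rfl⟩ | ⟨i, j, z, hij, rfl, rfl, rfl, rfl⟩ | ⟨h, z, rfl, rfl⟩ | ⟨h, z, rfl, rfl⟩
  · exact of_eq rfl rfl
  · exact of_circle hij (z * w) (mul_assoc _ _ _) (mul_assoc _ _ _)
  · exact of_adj h (z * w) (by simp only [mul_assoc]) (by simp only [mul_assoc])
  · exact of_far h (z * w) (mul_assoc _ _ _) (mul_assoc _ _ _)

/-- This is left cancellation by one generator: the three proper relations never relate a generator
to itself. -/
theorem eq (h : IsLcmMul a a x y) : x = y := by
  rcases h with ⟨-, h⟩ | ⟨i, j, z, hij, rfl, h, -⟩ | ⟨h, -⟩ | ⟨h, -⟩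
  · exact h
  · exact absurd (Gen.t.inj h) hij
  · simp only [Adj] at h; omega
  · simp only [Far] at h; omega

theorem circle {i j : ZMod e} (h : IsLcmMul (.t i) (.t j) x y) (hij : i ≠ j) :
    ∃ z, x = T r (i - 1) * z ∧ y = T r (j - 1) * z := by
  rcases h with ⟨h, -⟩ | ⟨i', j', z, -, h, h', hx, hy⟩ | ⟨h, -⟩ | ⟨h, -⟩
  · exact absurd (Gen.t.inj h) hij
  · cases h; cases h'; exact ⟨z, hx, hy⟩
  · simp [Adj] at h
  · simp [Far] at h

theorem adj (h : IsLcmMul a b x y) (hab : Adj a.rank b.rank) :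
    ∃ z, x = gen b * (gen a * z) ∧ y = gen a * (gen b * z) := by
  rcases h with ⟨rfl, -⟩ | ⟨i, j, z, -, rfl, rfl, -⟩ | ⟨-, h⟩ | ⟨h, -⟩
  · simp only [Adj] at hab; omega
  · simp [Adj] at hab
  · exact h
  · simp only [Adj, Far] at h hab; omega

theorem far (h : IsLcmMul a b x y) (hab : Far a.rank b.rank) :
    ∃ z, x = gen b * z ∧ y = gen a * z := by
  rcases h with ⟨rfl, -⟩ | ⟨i, j, z, -, rfl, rfl, -⟩ | ⟨h, -⟩ | ⟨-, h⟩
  · simp only [Far] at hab; omega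
  · simp [Far] at hab
  · simp only [Adj, Far] at h hab; omega
  · exact h

end IsLcmMul

/-- The lcm property of generators, for elements of length at most `n`. -/
def LcmProp (e r n : ℕ) : Prop :=
  ∀ (a b : Gen e r) (x y : BraidMonoid e r), length x + 1 ≤ n → gen a * x = gen b * y →
    IsLcmMul a b x y

/-! ### The cube condition for triples of generators -/

namespace LcmProp

variable {n : ℕ} {a b c : Gen e r} {z z' : BraidMonoid e r}

/-- This lemma and the next four are the cases of the cube condition, named after the relations of
the middle generator to the outer two. The hypothesis `h` equates the two descriptions of the middle
element, which is short enough for the induction hypothesis to unfold it. -/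
theorem circle_adj (ih : LcmProp e r n) (he : 2 ≤ e) {i k : ZMod e}
    (hb : Adj 0 b.rank) (hn : length z + 1 ≤ n)
    (h : T r (k - 1) * z = gen b * (T r k * z')) :
    IsLcmMul (.t i) b (T r (i - 1) * z) (T r k * (gen b * z')) := by
  have : Fact (1 < e) := ⟨he⟩
  obtain ⟨v, rfl, h2⟩ := (ih _ _ _ _ hn h).adj hb
  simp only [length_mul, length_gen] at hn
  obtain ⟨v1, rfl, h3⟩ := (ih _ _ _ _ (by
    have := congrArg length h2; simp only [length_mul, length_gen] at this; omega) h2).circle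
      (by simp [eq_comm (a := k)])
  obtain ⟨v2, rfl, rfl⟩ := (ih _ _ _ _ (by omega) h3).adj (a := b) (b := .t _) hb.symm
  refine .of_adj hb (T r (i - 1) * (gen b * (T r (i - 1 - 1) * v2))) ?_ ?_
  · rw [circle_assoc (k - 1) (i - 1), ← adj_braid_assoc (b := .t (i - 1)) hb.symm,
      adj_braid_assoc (b := .t (i - 1 - 1)) hb.symm, circle_assoc (i - 1) i]
  · rw [adj_braid_assoc (b := .t (k - 1)) hb.symm, circle_assoc k i, circle_assoc (k - 1) (i - 1),
      ← adj_braid_assoc (b := .t (i - 1)) hb.symm]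

theorem circle_far (ih : LcmProp e r n) {i k : ZMod e}
    (hb : Far 0 b.rank) (hn : length z + 1 ≤ n) (h : T r (k - 1) * z = gen b * z') :
    IsLcmMul (.t i) b (T r (i - 1) * z) (T r k * z') := by
  obtain ⟨v, rfl, rfl⟩ := (ih _ _ _ _ hn h).far hb
  refine .of_far hb (T r (i - 1) * v) ?_ (circle_assoc _ _ _)
  exact far_comm_assoc (a := .t _) hb _

theorem adj_far (ih : LcmProp e r n) (hca : Adj c.rank a.rank) (hcb : Far c.rank b.rank)
    (hn : length z + 2 ≤ n) (h : gen a * (gen c * z) = gen b * z') :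
    IsLcmMul a b (gen c * (gen a * z)) (gen c * z') := by
  have h1 := ih _ _ _ _ (by simp only [length_mul, length_gen]; omega) h
  by_cases hab : Far a.rank b.rank
  · obtain ⟨v, h2, rfl⟩ := h1.far hab
    obtain ⟨v', rfl, rfl⟩ := (ih _ _ _ _ (by omega) h2).far hcb
    refine .of_far hab (gen c * (gen a * v')) ?_ ?_
    · rw [far_comm_assoc hab, far_comm_assoc hcb]
    · rw [adj_braid_assoc hca]
  · have hab : Adj a.rank b.rank := by simp only [Adj, Far] at *; omega
    obtain ⟨v, h2, rfl⟩ := h1.adj hab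
    obtain ⟨v1, rfl, h3⟩ := (ih _ _ _ _ (by omega) h2).far hcb
    simp only [length_mul, length_gen] at hn
    obtain ⟨v2, rfl, rfl⟩ := (ih _ _ _ _ (by
      have := congrArg length h3; simp only [length_mul, length_gen] at this; omega) h3).adj hca.symm
    refine .of_adj hab (gen c * (gen a * (gen b * v2))) ?_ ?_
    · rw [adj_braid_assoc hab, far_comm_assoc hcb, ← far_comm_assoc hcb v2, adj_braid_assoc hca]
    · rw [← far_comm_assoc hcb, adj_braid_assoc hca, adj_braid_assoc hab, far_comm_assoc hcb]

/-- Two neighbours of `c` either lie on opposite sides of it, and then commute, or have equal rank,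
and then coincide or are both of type `t`. -/
theorem adj_adj (ih : LcmProp e r n) (hca : Adj c.rank a.rank) (hcb : Adj c.rank b.rank)
    (hn : length z + 2 ≤ n) (h : gen a * (gen c * z) = gen b * (gen c * z')) :
    IsLcmMul a b (gen c * (gen a * z)) (gen c * (gen b * z')) := by
  have h1 := ih _ _ _ _ (by simp only [length_mul, length_gen]; omega) h
  have hlen : length z' = length z := by
    have := congrArg length h; simp only [length_mul, length_gen] at this; omega
  by_cases hab : Far a.rank b.rank
  · obtain ⟨v, h2, h3⟩ := h1.far hab
    obtain ⟨z1, rfl, h4⟩ := (ih _ _ _ _ (by omega) h2).adj hcb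
    obtain ⟨z2, rfl, rfl⟩ := (ih _ _ _ _ (by omega) h3).adj hca
    simp only [length_mul, length_gen] at hn hlen
    have h5 := (ih _ _ _ _ (by simp only [length_mul, length_gen]; omega) h4).eq
    obtain ⟨v, rfl, rfl⟩ := (ih _ _ _ _ (by omega) h5).far hab
    refine .of_far hab (gen c * (gen b * (gen a * (gen c * v)))) ?_ ?_
    · rw [far_comm_assoc hab, ← adj_braid_assoc hca, adj_braid_assoc hcb]
    · rw [← far_comm_assoc hab, ← adj_braid_assoc hcb, adj_braid_assoc hca, far_comm_assoc hab]
  · have hab : a.rank = b.rank := by simp only [Adj, Far] at *; omega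
    rcases eq_of_rank_eq hab with rfl | ⟨i, j, rfl, rfl⟩
    · refine .of_eq rfl ?_
      rw [(ih _ _ _ _ (by omega) h1.eq).eq]
    · by_cases hij : i = j
      · subst hij
        refine .of_eq rfl ?_
        rw [(ih _ _ _ _ (by omega) h1.eq).eq]
      obtain ⟨v, h2, h3⟩ := h1.circle hij
      obtain ⟨z1, rfl, h4⟩ := (ih _ _ _ _ (by omega) h2).adj (b := .t _) hca
      obtain ⟨z2, rfl, rfl⟩ := (ih _ _ _ _ (by omega) h3).adj (b := .t _) hca
      simp only [length_mul, length_gen] at hn hlen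
      have h5 := (ih _ _ _ _ (by simp only [length_mul, length_gen]; omega) h4).eq
      obtain ⟨v, rfl, rfl⟩ := (ih _ _ _ _ (by omega) h5).circle (by simpa using Ne.symm hij)
      -- The factor after `T r (i - 1)` is normalised to index 1, so that `i` and `j` share one
      -- cofactor.
      have key : ∀ i : ZMod e, gen c * (T r i * (T r (i - 1) * (gen c * (T r (i - 1 - 1) * v)))) =
          T r (i - 1) * (gen c * (T r 1 * (T r (1 - 1) * (gen c * v)))) := fun i => by
        rw [circle_assoc i (i - 1), ← adj_braid_assoc (b := .t (i - 1 - 1)) hca,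
          adj_braid_assoc (b := .t (i - 1)) hca, circle_assoc (i - 1) 1]
      exact .of_circle hij _ (key i) (key j)

theorem far_far (ih : LcmProp e r n) (hca : Far c.rank a.rank) (hcb : Far c.rank b.rank)
    (hn : length z + 1 ≤ n) (h : gen a * z = gen b * z') :
    IsLcmMul a b (gen c * z) (gen c * z') := by
  rcases ih _ _ _ _ hn h with ⟨rfl, rfl⟩ | ⟨i, j, v, hij, rfl, rfl, rfl, rfl⟩ | ⟨hab, v, rfl, rfl⟩ |
    ⟨hab, v, rfl, rfl⟩
  · exact .of_eq rfl rfl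
  · exact .of_circle hij (gen c * v) (far_comm_assoc (b := .t (i - 1)) hca _)
      (far_comm_assoc (b := .t (j - 1)) hca _)
  · exact .of_adj hab (gen c * v) (by rw [far_comm_assoc hcb, far_comm_assoc hca])
      (by rw [far_comm_assoc hca, far_comm_assoc hcb])
  · exact .of_far hab (gen c * v) (far_comm_assoc hcb _) (far_comm_assoc hca _)

/-- The cube condition. -/
theorem trans (ih : LcmProp e r n) (he : 2 ≤ e) {x w y : BraidMonoid e r}
    (h : IsLcmMul a c x w) (h' : IsLcmMul c b w y) (hn : length w ≤ n) : IsLcmMul a b x y := by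
  have hxw : length x = length w := by
    rcases h with ⟨rfl, rfl⟩ | ⟨i, j, z, hij, rfl, rfl, rfl, rfl⟩ | ⟨h, z, rfl, rfl⟩ |
      ⟨h, z, rfl, rfl⟩ <;> simp
  have hwy : length w = length y := by
    rcases h' with ⟨rfl, rfl⟩ | ⟨i, j, z, hij, rfl, rfl, rfl, rfl⟩ | ⟨h, z, rfl, rfl⟩ |
      ⟨h, z, rfl, rfl⟩ <;> simp
  rcases h with ⟨rfl, rfl⟩ | ⟨i, k, z, hik, rfl, rfl, rfl, hw⟩ | ⟨hac, z, rfl, hw⟩ |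
    ⟨hac, z, rfl, hw⟩
  · exact h'
  · rcases h' with ⟨rfl, rfl⟩ | ⟨k', j, z', hkj, hk, rfl, hw', rfl⟩ | ⟨hcb, z', hw', rfl⟩ |
      ⟨hcb, z', hw', rfl⟩
    · exact .of_circle hik z rfl hw
    · cases hk
      have : z = z' := by
        refine (ih _ _ _ _ ?_ (hw.symm.trans hw')).eq
        simp only [length_mul, length_gen] at hxw; omega
      subst this
      by_cases hij : i = j
      · subst hij; exact .of_eq rfl rfl
      · exact .of_circle hij z rfl rfl
    · refine ih.circle_adj he hcb ?_ (hw.symm.trans hw')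
      simp only [length_mul, length_gen] at hxw; omega
    · refine ih.circle_far hcb ?_ (hw.symm.trans hw')
      simp only [length_mul, length_gen] at hxw; omega
  · rcases h' with ⟨rfl, rfl⟩ | ⟨k, j, z', hkj, rfl, rfl, hw', rfl⟩ | ⟨hcb, z', hw', rfl⟩ |
      ⟨hcb, z', hw', rfl⟩
    · exact .of_adj hac z rfl hw
    · refine (ih.circle_adj he hac.symm ?_ (hw'.symm.trans hw)).symm
      simp only [length_mul, length_gen] at hwy; omega
    · refine ih.adj_adj hac.symm hcb ?_ (hw.symm.trans hw')
      simp only [length_mul, length_gen] at hxw; omega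
    · refine ih.adj_far hac.symm hcb ?_ (hw.symm.trans hw')
      simp only [length_mul, length_gen] at hxw; omega
  · rcases h' with ⟨rfl, rfl⟩ | ⟨k, j, z', hkj, rfl, rfl, hw', rfl⟩ | ⟨hcb, z', hw', rfl⟩ |
      ⟨hcb, z', hw', rfl⟩
    · exact .of_far hac z rfl hw
    · refine (ih.circle_far hac.symm ?_ (hw'.symm.trans hw)).symm
      simp only [length_mul, length_gen] at hwy; omega
    · refine (ih.adj_far hcb hac.symm ?_ (hw'.symm.trans hw)).symm
      simp only [length_mul, length_gen] at hwy; omega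
    · refine ih.far_far hac.symm hcb ?_ (hw.symm.trans hw')
      simp only [length_mul, length_gen] at hxw; omega

end LcmProp

/-! ### The lcm property and left cancellation -/

theorem isLcmMul_of_rel {u v : FreeMonoid (Gen e r)} (h : Rel e r u v) {a b : Gen e r}
    {x y : FreeMonoid (Gen e r)} (hx : u = FreeMonoid.of a * x) (hy : v = FreeMonoid.of b * y) :
    IsLcmMul a b (PresentedMonoid.mk (Rel e r) x) (PresentedMonoid.mk (Rel e r) y) := by
  have cons {a a' : Gen e r} {x x' : FreeMonoid (Gen e r)}
      (h : FreeMonoid.of a * x = FreeMonoid.of a' * x') : a = a' ∧ x = x' := List.cons.inj h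
  cases h with
  | braid_s i j h =>
    rw [sw, sw, mul_assoc] at hx hy
    obtain ⟨rfl, rfl⟩ := cons hx
    obtain ⟨rfl, rfl⟩ := cons hy
    refine .of_adj ?_ 1 rfl rfl
    obtain ⟨i, hi⟩ := i; obtain ⟨j, hj⟩ := j
    rw [abs_eq (by norm_num)] at h
    simp only [Gen.rank, Adj] at *; omega
  | comm_s i j h =>
    obtain ⟨rfl, rfl⟩ := cons hx
    obtain ⟨rfl, rfl⟩ := cons hy
    refine .of_far ?_ 1 rfl rfl
    obtain ⟨i, hi⟩ := i; obtain ⟨j, hj⟩ := j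
    rw [lt_abs] at h
    simp only [Gen.rank, Far] at *; omega
  | braid_t j h i =>
    rw [sw, tw, mul_assoc] at hx hy
    obtain ⟨rfl, rfl⟩ := cons hx
    obtain ⟨rfl, rfl⟩ := cons hy
    refine .of_adj ?_ 1 rfl rfl
    simp only [Gen.rank, Adj]; omega
  | comm_t j h i =>
    obtain ⟨rfl, rfl⟩ := cons hx
    obtain ⟨rfl, rfl⟩ := cons hy
    refine .of_far ?_ 1 rfl rfl
    simp only [Gen.rank, Far]; omega
  | circle i j =>
    obtain ⟨rfl, rfl⟩ := cons hx
    obtain ⟨rfl, rfl⟩ := cons hy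
    by_cases h : i = j
    · subst h; exact .of_eq rfl rfl
    · exact .of_circle h 1 rfl rfl

@[simp] theorem length_mk (u : FreeMonoid (Gen e r)) :
    length (PresentedMonoid.mk (Rel e r) u) = u.length := by
  induction u using FreeMonoid.inductionOn' with
  | one => simp
  | of_mul a w ih =>
    rw [map_mul, length_mul, ih, FreeMonoid.length_mul, FreeMonoid.length_of]
    exact congrArg (· + _) (length_gen a)

/-- Induction on a derivation of `u = v`. Only transitivity needs the cube condition; the
intermediate word is nonempty because derivations preserve length. -/
theorem LcmProp.of_conGen {n : ℕ} (he : 2 ≤ e) (ih : LcmProp e r n) {u v : FreeMonoid (Gen e r)}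
    (h : ConGen.Rel (Rel e r) u v) {a b : Gen e r} {x y : FreeMonoid (Gen e r)}
    (hx : u = FreeMonoid.of a * x) (hy : v = FreeMonoid.of b * y) (hn : x.length ≤ n) :
    IsLcmMul a b (PresentedMonoid.mk (Rel e r) x) (PresentedMonoid.mk (Rel e r) y) := by
  have cons {a a' : Gen e r} {x x' : FreeMonoid (Gen e r)}
      (h : FreeMonoid.of a * x = FreeMonoid.of a' * x') : a = a' ∧ x = x' := List.cons.inj h
  have split (u : FreeMonoid (Gen e r)) : u = 1 ∨ ∃ a x, u = FreeMonoid.of a * x := by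
    induction u using FreeMonoid.inductionOn' with
    | one => exact Or.inl rfl
    | of_mul a w _ => exact Or.inr ⟨a, w, rfl⟩
  have len {u v : FreeMonoid (Gen e r)} (h : ConGen.Rel (Rel e r) u v) :
      u.length = v.length := by
    rw [← length_mk, ← length_mk, PresentedMonoid.mk_eq_mk_iff.2 h]
  induction h generalizing a b x y with
  | of u v h => exact isLcmMul_of_rel h hx hy
  | refl u =>
    subst hx
    obtain ⟨rfl, rfl⟩ := cons hy
    exact .of_eq rfl rfl
  | symm h ih' =>
    refine (ih' hy hx ?_).symm
    have := len h
    simp only [hx, hy, FreeMonoid.length_mul, FreeMonoid.length_of] at this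
    omega
  | @trans u v w h h' ih1 ih2 =>
    have h1 := len h
    have h2 := len h'
    rcases split v with rfl | ⟨c, w, rfl⟩
    · simp [hx] at h1
    · simp only [hx, hy, FreeMonoid.length_mul, FreeMonoid.length_of] at h1 h2
      exact ih.trans he (ih1 hx rfl hn) (ih2 rfl hy (by omega)) (by rw [length_mk]; omega)
  | @mul u v u' v' h h' ih1 ih2 =>
    have h1 := len h
    -- An empty left factor passes the question to the right one; otherwise the first letters lie in
    -- the left factors and the right ones only multiply the cofactors.
    rcases split u with rfl | ⟨c, w, rfl⟩
    · obtain rfl : v = 1 := by rwa [FreeMonoid.length_one, eq_comm, FreeMonoid.length_eq_zero] at h1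
      rw [one_mul] at hx hy
      exact ih2 hx hy hn
    · rcases split v with rfl | ⟨d, w', rfl⟩
      · simp at h1
      · rw [mul_assoc] at hx hy
        obtain ⟨rfl, rfl⟩ := cons hx
        obtain ⟨rfl, rfl⟩ := cons hy
        rw [FreeMonoid.length_mul] at hn
        have := (ih1 rfl rfl (by omega)).mul_right (PresentedMonoid.mk (Rel e r) u')
        rw [map_mul, map_mul]
        convert this using 2
        exact (PresentedMonoid.mk_eq_mk_iff.2 h').symm

theorem lcmProp (he : 2 ≤ e) (n : ℕ) : LcmProp e r n := by
  induction n with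
  | zero => intro a b x y h; omega
  | succ n ih =>
    intro a b x y hn h
    induction x, y using PresentedMonoid.inductionOn₂ with
    | _ x y =>
      rw [length_mk] at hn
      exact ih.of_conGen he (PresentedMonoid.mk_eq_mk_iff.1 h) rfl rfl (by omega)

theorem isLcmMul (he : 2 ≤ e) {a b : Gen e r} {x y : BraidMonoid e r}
    (h : gen a * x = gen b * y) : IsLcmMul a b x y :=
  lcmProp he _ a b x y le_rfl h

theorem mul_cancel (he : 2 ≤ e) (x : BraidMonoid e r) {y z : BraidMonoid e r}
    (h : x * y = x * z) : y = z := by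
  induction x using gen_induction with
  | one => simpa using h
  | gen_mul a x ih => exact ih (isLcmMul he (by simpa only [mul_assoc] using h)).eq

theorem dvd_of_mul_dvd_mul (he : 2 ≤ e) (x : BraidMonoid e r) {y z : BraidMonoid e r}
    (h : x * y ∣ x * z) : y ∣ z := by
  obtain ⟨w, hw⟩ := h
  exact ⟨w, mul_cancel he x (by rw [hw, mul_assoc])⟩

theorem dvd_of_adj (he : 2 ≤ e) {a b : Gen e r} (hab : Adj a.rank b.rank) {x : BraidMonoid e r}
    (h : gen a ∣ gen b * x) : gen a * gen b ∣ x := by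
  obtain ⟨y, hy⟩ := h
  obtain ⟨z, rfl, -⟩ := (isLcmMul he hy).adj hab.symm
  exact ⟨z, by rw [mul_assoc]⟩

theorem dvd_of_circle (he : 2 ≤ e) {i j : ZMod e} (hij : i ≠ j) {x : BraidMonoid e r}
    (h : T r i ∣ T r j * x) : T r (j - 1) ∣ x := by
  obtain ⟨y, hy⟩ := h
  obtain ⟨z, rfl, -⟩ := (isLcmMul he hy).circle hij.symm
  exact ⟨z, rfl⟩

theorem gen_injective (he : 2 ≤ e) : Function.Injective (gen : Gen e r → BraidMonoid e r) := by
  intro a b h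
  rcases isLcmMul he (congrArg (· * 1) h) with ⟨h, -⟩ | ⟨i, j, z, -, -, -, h, -⟩ | ⟨-, z, h, -⟩ |
    ⟨-, z, h, -⟩
  · exact h
  all_goals
    have := congrArg length h
    simp only [length_one, length_mul, length_gen] at this
    omega

/-! ### Elements supported on a set of ranks -/

open Classical in
/-- The homomorphism to `ℕ` with value `1` on the generators whose rank is in `Q` and `0` on the
other generators. -/
noncomputable def supportHom (Q : Set ℕ) : BraidMonoid e r →* ℕ :=
  PresentedMonoid.lift (fun a => if a.rank ∈ Q then 1 else 0) (by
    intro u v h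
    cases h with
    -- The two sides contain the letters with different multiplicities, which is harmless because 0
    -- and 1 are idempotent.
    | braid_s i j h => simp only [sw, map_mul, FreeMonoid.lift_eval_of]; split_ifs <;> rfl
    | comm_s i j h => simp only [sw, map_mul, FreeMonoid.lift_eval_of, mul_comm]
    | braid_t j h i => simp only [sw, tw, map_mul, FreeMonoid.lift_eval_of]; split_ifs <;> rfl
    | comm_t j h i => simp only [sw, tw, map_mul, FreeMonoid.lift_eval_of, mul_comm]
    | circle i j => simp only [tw, map_mul, FreeMonoid.lift_eval_of, rank_t]; rfl)

/-- The submonoid of the elements all of whose letters have rank in `Q`. -/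
noncomputable def supported (Q : Set ℕ) : Submonoid (BraidMonoid e r) :=
  MonoidHom.mker (supportHom Q)

theorem gen_mem_supported {Q : Set ℕ} {a : Gen e r} : gen a ∈ supported Q ↔ a.rank ∈ Q := by
  classical
  have : supportHom Q (gen a) = if a.rank ∈ Q then 1 else 0 := rfl
  rw [supported, MonoidHom.mem_mker, this]
  split_ifs with h <;> simp [h]

theorem mul_mem_supported {Q : Set ℕ} {x y : BraidMonoid e r} :
    x * y ∈ supported Q ↔ x ∈ supported Q ∧ y ∈ supported Q := by
  simp only [supported, MonoidHom.mem_mker, map_mul, mul_eq_one]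

theorem supported_mono {Q Q' : Set ℕ} (h : Q ⊆ Q') {x : BraidMonoid e r} (hx : x ∈ supported Q) :
    x ∈ supported Q' := by
  induction x using gen_induction with
  | one => exact one_mem _
  | gen_mul a x ih =>
    rw [mul_mem_supported, gen_mem_supported] at hx ⊢
    exact ⟨h hx.1, ih hx.2⟩

theorem gen_comm_of_far {Q : Set ℕ} {a : Gen e r} (hQ : ∀ k ∈ Q, Far a.rank k)
    {x : BraidMonoid e r} (hx : x ∈ supported Q) : gen a * x = x * gen a := by
  induction x using gen_induction with
  | one => simp
  | gen_mul b x ih =>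
    rw [mul_mem_supported, gen_mem_supported] at hx
    rw [far_comm_assoc (hQ _ hx.1), ih hx.2, mul_assoc]

/-- The lcm of `gen a` with an element whose letters all commute with it is their product, found by
pushing `gen a` through `x` letter by letter. -/
theorem eq_mul_of_far (he : 2 ≤ e) {Q : Set ℕ} {a : Gen e r} (hQ : ∀ k ∈ Q, Far a.rank k)
    {x y z : BraidMonoid e r} (hx : x ∈ supported Q) (h : gen a * y = x * z) :
    ∃ w, z = gen a * w ∧ y = x * w := by
  induction x using gen_induction generalizing y with
  | one => exact ⟨y, by simpa using h.symm, by simp⟩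
  | gen_mul b x ih =>
    rw [mul_mem_supported, gen_mem_supported] at hx
    rw [mul_assoc] at h
    obtain ⟨v, rfl, hv⟩ := (isLcmMul he h).far (hQ _ hx.1)
    obtain ⟨w, rfl, rfl⟩ := ih hx.2 hv.symm
    exact ⟨w, rfl, by rw [mul_assoc]⟩

theorem dvd_of_far (he : 2 ≤ e) {Q : Set ℕ} {a : Gen e r} (hQ : ∀ k ∈ Q, Far a.rank k)
    {x z : BraidMonoid e r} (hx : x ∈ supported Q) (h : gen a ∣ x * z) : gen a ∣ z := by
  obtain ⟨y, hy⟩ := h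
  obtain ⟨w, rfl, -⟩ := eq_mul_of_far he hQ hx hy.symm
  exact ⟨w, rfl⟩

theorem eq_mul_of_far_supported (he : 2 ≤ e) {Q Q' : Set ℕ} (hQ : ∀ j ∈ Q, ∀ k ∈ Q', Far j k)
    {x u y z : BraidMonoid e r} (hu : u ∈ supported Q) (hx : x ∈ supported Q')
    (h : u * y = x * z) : ∃ w, z = u * w ∧ y = x * w := by
  induction u using gen_induction generalizing z with
  | one => exact ⟨z, by simp, by simpa using h⟩
  | gen_mul a u ih =>
    rw [mul_mem_supported, gen_mem_supported] at hu
    rw [mul_assoc] at h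
    obtain ⟨v, rfl, hv⟩ := eq_mul_of_far he (hQ _ hu.1) hx h
    obtain ⟨w, rfl, rfl⟩ := ih hu.2 hv
    exact ⟨w, by rw [mul_assoc], rfl⟩

/-! ### Parabolic decomposition -/

/-- No generator of rank less than `m` divides `c`. -/
def IsReduced (m : ℕ) (c : BraidMonoid e r) : Prop := ∀ a : Gen e r, a.rank < m → ¬ gen a ∣ c

theorem exists_decomposition (m : ℕ) (w : BraidMonoid e r) :
    ∃ x ∈ supported (Set.Iio m), ∃ c, IsReduced m c ∧ w = x * c := by
  induction hn : length w using Nat.strong_induction_on generalizing w with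
  | _ n ih =>
    by_cases h : IsReduced m w
    · exact ⟨1, one_mem _, w, h, (one_mul w).symm⟩
    · simp only [IsReduced, not_forall, not_not] at h
      obtain ⟨a, ha, v, rfl⟩ := h
      rw [length_mul, length_gen] at hn
      obtain ⟨x, hx, c, hc, rfl⟩ := ih _ (by omega) v rfl
      exact ⟨gen a * x, mul_mem (gen_mem_supported.2 ha) hx, c, hc, (mul_assoc _ _ _).symm⟩

/-- A parabolic submonoid contains the lcm of any two of its generators; uniqueness of the
decomposition rests on this. -/
theorem IsLcmMul.exists_supported {m : ℕ} {a b : Gen e r} {x y : BraidMonoid e r}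
    (h : IsLcmMul a b x y) (ha : a.rank < m) (hb : b.rank < m) :
    ∃ u ∈ supported (Set.Iio m), ∃ v ∈ supported (Set.Iio m), ∃ z,
      x = u * z ∧ y = v * z ∧ gen a * u = gen b * v := by
  have hA : gen a ∈ supported (Set.Iio m) := gen_mem_supported.2 ha
  have hB : gen b ∈ supported (Set.Iio m) := gen_mem_supported.2 hb
  rcases h with ⟨rfl, rfl⟩ | ⟨i, j, z, -, rfl, rfl, rfl, rfl⟩ | ⟨h, z, rfl, rfl⟩ | ⟨h, z, rfl, rfl⟩
  · exact ⟨1, one_mem _, 1, one_mem _, x, by simp⟩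
  · exact ⟨T r (i - 1), gen_mem_supported.2 ha, T r (j - 1), gen_mem_supported.2 ha, z, rfl, rfl,
      CorranPicantin.circle _ _⟩
  · exact ⟨_, mul_mem hB hA, _, mul_mem hA hB, z, by rw [mul_assoc], by rw [mul_assoc],
      adj_braid h⟩
  · exact ⟨_, hB, _, hA, z, rfl, rfl, far_comm h⟩

theorem decomposition_unique (he : 2 ≤ e) {m : ℕ} {x x' c c' : BraidMonoid e r}
    (hx : x ∈ supported (Set.Iio m)) (hx' : x' ∈ supported (Set.Iio m)) (hc : IsReduced m c)
    (hc' : IsReduced m c') (h : x * c = x' * c') : x = x' ∧ c = c' := by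
  induction hn : length (x * c) using Nat.strong_induction_on generalizing x x' c c' with
  | _ n ih =>
    rcases eq_one_or_gen_mul x with rfl | ⟨a, x, rfl⟩ <;>
      rcases eq_one_or_gen_mul x' with rfl | ⟨b, x', rfl⟩
    · simpa using h
    · rw [mul_mem_supported, gen_mem_supported] at hx'
      rw [one_mul, mul_assoc] at h
      exact absurd ⟨_, h⟩ (hc b hx'.1)
    · rw [mul_mem_supported, gen_mem_supported] at hx
      rw [one_mul, mul_assoc] at h
      exact absurd ⟨_, h.symm⟩ (hc' a hx.1)
    · rw [mul_mem_supported, gen_mem_supported] at hx hx'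
      rw [mul_assoc, mul_assoc] at h
      rw [mul_assoc, length_mul, length_gen] at hn
      have hlen := congrArg length h
      simp only [length_mul, length_gen] at hlen hn
      obtain ⟨u, hu, v, hv, z, h1, h2, huv⟩ := (isLcmMul he h).exists_supported hx.1 hx'.1
      -- Decomposing the cofactor of the lcm gives a second decomposition of each tail, and the
      -- tails are shorter.
      obtain ⟨y, hy, d, hd, rfl⟩ := exists_decomposition m z
      rw [← mul_assoc] at h1 h2
      obtain ⟨rfl, rfl⟩ := ih _ (by rw [length_mul]; omega) hx.2 (mul_mem hu hy) hc hd h1 rfl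
      obtain ⟨rfl, rfl⟩ := ih _ (by rw [length_mul]; omega) hx'.2 (mul_mem hv hy) hc' hd h2 rfl
      exact ⟨by rw [← mul_assoc, huv, mul_assoc], rfl⟩

/-- If `x * c` is divisible by `z`, with `c` reduced, and `z` only has letters of rank less than
`m`, then `x` is divisible by `z`. -/
theorem dvd_of_dvd_mul_isReduced (he : 2 ≤ e) {m : ℕ} {x z c : BraidMonoid e r}
    (hx : x ∈ supported (Set.Iio m)) (hz : z ∈ supported (Set.Iio m)) (hc : IsReduced m c)
    (h : z ∣ x * c) : z ∣ x := by
  obtain ⟨w, hw⟩ := h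
  obtain ⟨y, hy, d, hd, rfl⟩ := exists_decomposition m w
  rw [← mul_assoc] at hw
  exact ⟨y, (decomposition_unique he hx (mul_mem hz hy) hc hd hw).1⟩

/-! ### The elements `lam m` and the Garside element -/

/-- The generator of rank `p ≥ 1`, that is `s (p + 2)`; it is `1` if there is no such generator. -/
def S (e r p : ℕ) : BraidMonoid e r :=
  if h : 3 ≤ p + 2 ∧ p + 2 ≤ r then gen (.s ⟨p + 2, h⟩) else 1

/-- The product `t i * t (i - 1)`, which does not depend on `i`. -/
def tau (e r : ℕ) : BraidMonoid e r := T r 1 * T r (1 - 1)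

theorem tau_eq (i : ZMod e) : tau e r = T r i * T r (i - 1) := circle _ _

theorem S_eq_gen {p : ℕ} (h : 1 ≤ p) (h' : p + 2 ≤ r) :
    ∃ a : Gen e r, a.rank = p ∧ S e r p = gen a :=
  ⟨.s ⟨p + 2, by omega, h'⟩, rfl, dif_pos ⟨by omega, h'⟩⟩

theorem gen_eq_S {a : Gen e r} (h : 1 ≤ a.rank) : gen a = S e r a.rank := by
  rcases a with i | ⟨j, hj⟩
  · simp at h
  · have h2 : j - 2 + 2 = j := by omega
    simp only [Gen.rank, S, h2, hj, and_self, dite_true]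

theorem rank_add_two_le (a : Gen e r) (h : 1 ≤ a.rank) : a.rank + 2 ≤ r := by
  rcases a with i | ⟨j, hj⟩
  · simp at h
  · simp only [Gen.rank]; omega

theorem S_mem {Q : Set ℕ} {p : ℕ} (h : p ∈ Q) : S e r p ∈ supported Q := by
  unfold S
  split_ifs with hp
  · exact gen_mem_supported.2 h
  · exact one_mem _

theorem T_mem {Q : Set ℕ} (h : 0 ∈ Q) (i : ZMod e) : T r i ∈ supported Q := gen_mem_supported.2 h

theorem tau_mem {Q : Set ℕ} (h : 0 ∈ Q) : tau e r ∈ supported Q :=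
  mul_mem (T_mem h _) (T_mem h _)

theorem comm_of_far {Q Q' : Set ℕ} (hQ : ∀ j ∈ Q, ∀ k ∈ Q', Far j k)
    {x y : BraidMonoid e r} (hx : x ∈ supported Q) (hy : y ∈ supported Q') : x * y = y * x := by
  induction x using gen_induction with
  | one => simp
  | gen_mul a x ih =>
    rw [mul_mem_supported, gen_mem_supported] at hx
    rw [mul_assoc, ih hx.2, ← mul_assoc, gen_comm_of_far (hQ _ hx.1) hy, mul_assoc]

theorem S_comm {p : ℕ} {Q : Set ℕ} (hQ : ∀ k ∈ Q, Far p k) {x : BraidMonoid e r}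
    (hx : x ∈ supported Q) : S e r p * x = x * S e r p :=
  comm_of_far (Q := {p}) (fun j hj => by rw [Set.mem_singleton_iff.1 hj]; exact hQ)
    (S_mem (Set.mem_singleton _)) hx

theorem S_comm_assoc {p : ℕ} {Q : Set ℕ} (hQ : ∀ k ∈ Q, Far p k) {x : BraidMonoid e r}
    (hx : x ∈ supported Q) (y : BraidMonoid e r) : S e r p * (x * y) = x * (S e r p * y) := by
  rw [← mul_assoc, S_comm hQ hx, mul_assoc]

theorem S_braid {p : ℕ} (h : 1 ≤ p) (h' : p + 3 ≤ r) :
    S e r p * (S e r (p + 1) * S e r p) = S e r (p + 1) * (S e r p * S e r (p + 1)) := by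
  obtain ⟨a, ha, ha'⟩ := S_eq_gen (e := e) (r := r) h (by omega)
  obtain ⟨b, hb, hb'⟩ := S_eq_gen (e := e) (p := p + 1) (by omega) h'
  rw [ha', hb']
  exact adj_braid (by rw [ha, hb]; exact Or.inl rfl)

theorem S_braid_assoc {p : ℕ} (h : 1 ≤ p) (h' : p + 3 ≤ r) (x : BraidMonoid e r) :
    S e r p * (S e r (p + 1) * (S e r p * x)) =
      S e r (p + 1) * (S e r p * (S e r (p + 1) * x)) := by
  simpa only [mul_assoc] using congrArg (· * x) (S_braid h h')

theorem T_braid (h : 3 ≤ r) (i : ZMod e) :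
    T r i * (S e r 1 * T r i) = S e r 1 * (T r i * S e r 1) := by
  obtain ⟨a, ha, ha'⟩ := S_eq_gen (e := e) le_rfl h
  rw [ha']
  exact adj_braid (by rw [ha]; exact Or.inl rfl)

theorem T_braid_assoc (h : 3 ≤ r) (i : ZMod e) (x : BraidMonoid e r) :
    T r i * (S e r 1 * (T r i * x)) = S e r 1 * (T r i * (S e r 1 * x)) := by
  simpa only [mul_assoc] using congrArg (· * x) (T_braid h i)

/-- The element `s (m + 2) ⋯ s 3 * t 1 * t 0 * s 3 ⋯ s (m + 2)`. -/
def lam (e r : ℕ) : ℕ → BraidMonoid e r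
  | 0 => tau e r
  | m + 1 => S e r (m + 1) * (lam e r m * S e r (m + 1))

/-- The product `lam 0 * ⋯ * lam (m - 1)`; for `m = r - 1` it is the minimal Garside element. -/
def Delta (e r : ℕ) : ℕ → BraidMonoid e r
  | 0 => 1
  | m + 1 => Delta e r m * lam e r m

theorem lam_mem {Q : Set ℕ} {m : ℕ} (h : ∀ k ≤ m, k ∈ Q) : lam e r m ∈ supported Q := by
  induction m with
  | zero => exact tau_mem (h 0 le_rfl)
  | succ m ih =>
    have := S_mem (e := e) (r := r) (h (m + 1) le_rfl)
    exact mul_mem this (mul_mem (ih fun k hk => h k (by omega)) this)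

theorem Delta_mem {Q : Set ℕ} {m : ℕ} (h : ∀ k < m, k ∈ Q) : Delta e r m ∈ supported Q := by
  induction m with
  | zero => exact one_mem _
  | succ m ih =>
    exact mul_mem (ih fun k hk => h k (by omega)) (lam_mem fun k hk => h k (by omega))

/-- The shift of the index of a generator `t i`. -/
def Gen.shift (k : ZMod e) : Gen e r → Gen e r
  | .t i => .t (i + k)
  | .s j => .s j

/-- The endomorphism `t i ↦ t (i + k)`, `s j ↦ s j`. -/
def shift (k : ZMod e) : BraidMonoid e r →* BraidMonoid e r :=
  PresentedMonoid.lift (fun a => gen (a.shift k)) (by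
    intro u v h
    cases h with
    | braid_s i j h =>
      simp only [sw, map_mul, FreeMonoid.lift_eval_of]
      exact mk_eq_of_rel (Rel.braid_s i j h)
    | comm_s i j h =>
      simp only [sw, map_mul, FreeMonoid.lift_eval_of]
      exact mk_eq_of_rel (Rel.comm_s i j h)
    | braid_t j h i =>
      simp only [sw, tw, map_mul, FreeMonoid.lift_eval_of]
      exact mk_eq_of_rel (Rel.braid_t j h (i + k))
    | comm_t j h i =>
      simp only [sw, tw, map_mul, FreeMonoid.lift_eval_of]
      exact mk_eq_of_rel (Rel.comm_t j h (i + k))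
    | circle i j =>
      simpa only [sw, tw, map_mul, FreeMonoid.lift_eval_of, Gen.shift, add_sub_right_comm] using
        circle (i + k) (j + k))

theorem shift_gen (k : ZMod e) (a : Gen e r) : shift k (gen a) = gen (a.shift k) := rfl

theorem shift_T (k i : ZMod e) : shift k (T r i) = T r (i + k) := rfl

theorem shift_S (k : ZMod e) (p : ℕ) : shift k (S e r p) = S e r p := by
  unfold S
  split_ifs
  · rfl
  · exact map_one _

theorem shift_lam (k : ZMod e) (m : ℕ) : shift k (lam e r m) = lam e r m := by
  induction m with
  | zero =>
    rw [lam, tau, map_mul, shift_T, shift_T, ← add_sub_right_comm]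
    exact circle _ _
  | succ m ih => rw [lam, map_mul, map_mul, shift_S, ih]

theorem shift_Delta (k : ZMod e) (m : ℕ) : shift k (Delta e r m) = Delta e r m := by
  induction m with
  | zero => exact map_one _
  | succ m ih => rw [Delta, map_mul, ih, shift_lam]

theorem shift_shift_neg (k : ZMod e) (x : BraidMonoid e r) : shift k (shift (-k) x) = x := by
  induction x using gen_induction with
  | one => rw [map_one, map_one]
  | gen_mul a x ih =>
    rw [map_mul, map_mul, ih, shift_gen, shift_gen]
    congr 2
    rcases a with i | j
    · simp [Gen.shift]
    · rfl

theorem shift_mem_supported {Q : Set ℕ} (k : ZMod e) {x : BraidMonoid e r}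
    (hx : x ∈ supported Q) : shift k x ∈ supported Q := by
  induction x using gen_induction with
  | one => rw [map_one]; exact one_mem _
  | gen_mul a x ih =>
    rw [mul_mem_supported, gen_mem_supported] at hx
    rw [map_mul]
    refine mul_mem ?_ (ih hx.2)
    rw [shift_gen, gen_mem_supported]
    rcases a with i | j <;> exact hx.1

/-! ### Commutation with `lam m` -/

theorem T_mul_lam_zero (i : ZMod e) : T r i * lam e r 0 = lam e r 0 * T r (i - 2) := by
  rw [lam, tau_eq (i - 1), ← mul_assoc, circle i (i - 1), mul_assoc, mul_assoc,
    show i - 1 - 1 = i - 2 by ring]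

theorem S_far_T {p : ℕ} (hp : 2 ≤ p) (i : ZMod e) : S e r p * T r i = T r i * S e r p :=
  S_comm (Q := {0}) (fun k hk => by rw [Set.mem_singleton_iff.1 hk]; right; omega) (T_mem (Set.mem_singleton _) i)

/-- For `m = 1`, two braid relations carry `t i` through `s 3 * tau * s 3`, from which it emerges as
`t (i - 1)`. The outer letters of a larger `lam m` commute with it. -/
theorem T_mul_lam {m : ℕ} (hm : 1 ≤ m) (h : m + 2 ≤ r) (i : ZMod e) :
    T r i * lam e r m = lam e r m * T r (i - 1) := by
  induction m, hm using Nat.le_induction with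
  | base =>
    rw [lam, lam]
    calc T r i * (S e r 1 * (tau e r * S e r 1))
        = T r i * (S e r 1 * (T r i * (T r (i - 1) * S e r 1))) := by
          rw [tau_eq i]; simp only [mul_assoc]
      _ = S e r 1 * (T r i * (T r (i - 1) * (S e r 1 * T r (i - 1)))) := by
          rw [T_braid_assoc h, T_braid h]
      _ = _ := by rw [tau_eq i]; simp only [mul_assoc]
  | succ m hm ih =>
    have hS := S_far_T (e := e) (r := r) (p := m + 1) (by omega)
    rw [lam, ← mul_assoc, ← hS, mul_assoc, ← mul_assoc (T r i), ih (by omega)]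
    simp only [mul_assoc, hS]

theorem S_far_lam {p m : ℕ} (h : m + 2 ≤ p) : S e r p * lam e r m = lam e r m * S e r p :=
  S_comm (Q := Set.Iic m) (fun k hk => by rw [Set.mem_Iic] at hk; right; omega)
    (lam_mem fun _ hk => hk)

theorem S_far_lam_assoc {p m : ℕ} (h : m + 2 ≤ p) (x : BraidMonoid e r) :
    S e r p * (lam e r m * x) = lam e r m * (S e r p * x) := by
  rw [← mul_assoc, S_far_lam h, mul_assoc]

theorem S_far_S {p q : ℕ} (h : p + 2 ≤ q) : S e r p * S e r q = S e r q * S e r p :=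
  S_comm (Q := {q}) (fun k hk => by rw [Set.mem_singleton_iff.1 hk]; left; omega) (S_mem (Set.mem_singleton _))

theorem S_mul_lam {p m : ℕ} (hp : 1 ≤ p) (hpm : p < m) (h : m + 2 ≤ r) :
    S e r p * lam e r m = lam e r m * S e r p := by
  induction m with
  | zero => omega
  | succ m ih =>
    rcases Nat.lt_succ_iff_lt_or_eq.1 hpm with hlt | rfl
    · have hS := S_far_S (e := e) (r := r) (p := p) (q := m + 1) (by omega)
      rw [lam, ← mul_assoc, hS, mul_assoc, ← mul_assoc (S e r p), ih hlt (by omega)]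
      simp only [mul_assoc, hS]
    · obtain ⟨q, rfl⟩ : ∃ q, p = q + 1 := ⟨p - 1, by omega⟩
      rw [lam, lam]
      simp only [mul_assoc]
      rw [S_braid_assoc (by omega) (by omega), S_far_lam_assoc (by omega),
        ← S_braid (by omega) (by omega)]

/-- For `m = 0` there are no letters to move, so the exceptional rotation by 2 under `lam 0` does
not intervene. -/
theorem mul_lam {m : ℕ} (h : m + 2 ≤ r) {y : BraidMonoid e r}
    (hy : y ∈ supported (Set.Iio m)) : y * lam e r m = lam e r m * shift (-1) y := by
  induction y using gen_induction with
  | one => simp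
  | gen_mul a y ih =>
    rw [mul_mem_supported, gen_mem_supported, Set.mem_Iio] at hy
    rw [map_mul, mul_assoc, ih hy.2, ← mul_assoc, ← mul_assoc]
    congr 1
    rcases Nat.eq_zero_or_pos a.rank with ha | ha
    · rcases a with i | ⟨j, hj⟩
      · rw [shift_gen, T_mul_lam (by omega) h, Gen.shift, sub_eq_add_neg]
      · simp only [Gen.rank] at ha; omega
    · rw [gen_eq_S ha, shift_S, S_mul_lam ha hy.1 h]

theorem Delta_mul_lam {m : ℕ} (h : m + 2 ≤ r) :
    Delta e r m * lam e r m = lam e r m * Delta e r m := by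
  rw [mul_lam h (Delta_mem fun _ hk => hk), shift_Delta]

/-- The element `Delta m` is quasi-central among the elements with letters of rank less than `m`. -/
theorem gen_mul_Delta {m : ℕ} (h : m + 1 ≤ r) (a : Gen e r) (ha : a.rank < m) :
    gen a * Delta e r m = Delta e r m * gen (a.shift (-((m : ZMod e) + 1))) := by
  induction m with
  | zero => omega
  | succ m ih =>
    by_cases ham : a.rank < m
    · rw [Delta, ← mul_assoc, ih (by omega) ham, mul_assoc, mul_lam (by omega), ← mul_assoc,
        shift_gen]
      · congr 2
        rcases a with i | j
        · simp only [Gen.shift, Gen.t.injEq]; push_cast; ring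
        · rfl
      · rw [gen_mem_supported]
        rcases a with i | j <;> exact ham
    · have ham : a.rank = m := by omega
      rcases a with i | j
      · obtain rfl : m = 0 := ham.symm
        -- `lam 0` rotates by 2 and each later factor by 1, whence `m + 1` for a product of `m`
        -- factors.
        rw [Delta, Delta, one_mul, T_mul_lam_zero, Gen.shift]
        congr 3; push_cast; ring
      · have h1 : 1 ≤ m := by rw [← ham]; have := j.2.1; simp only [Gen.rank]; omega
        obtain ⟨n, rfl⟩ : ∃ n, m = n + 1 := ⟨m - 1, by omega⟩
        rw [Gen.shift, gen_eq_S (by omega), ham, Delta, Delta, mul_assoc,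
          S_comm_assoc (Q := Set.Iio n) (fun k hk => by rw [Set.mem_Iio] at hk; right; omega)
            (Delta_mem fun _ hk => hk), mul_assoc]
        congr 1
        -- `lam n` commutes with `lam (n + 1)`, being fixed by rotation; this is a braid relation of
        -- length four between `lam n` and the generator of rank `n + 1`.
        have hl : lam e r n * (S e r (n + 1) * (lam e r n * S e r (n + 1))) =
            S e r (n + 1) * (lam e r n * (S e r (n + 1) * lam e r n)) := by
          have := mul_lam (e := e) (r := r) (m := n + 1) (by omega) (y := lam e r n)
            (lam_mem fun k hk => Set.mem_Iio.2 (by omega))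
          rw [shift_lam, lam] at this
          simpa only [mul_assoc] using this
        rw [lam, hl]
        simp only [mul_assoc]
        rw [hl]

/-! ### Divisibility of `lam m` and `Delta m` by generators -/

theorem S_eq_mul_of_far (he : 2 ≤ e) {p : ℕ} (h : 1 ≤ p) (h' : p + 2 ≤ r) {Q : Set ℕ}
    (hQ : ∀ k ∈ Q, Far p k) {x y z : BraidMonoid e r} (hx : x ∈ supported Q)
    (hy : S e r p * y = x * z) : ∃ w, z = S e r p * w ∧ y = x * w := by
  obtain ⟨a, rfl, ha⟩ := S_eq_gen (e := e) h h'
  rw [ha] at hy ⊢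
  exact eq_mul_of_far he hQ hx hy

theorem S_dvd_of_far (he : 2 ≤ e) {p : ℕ} (h : 1 ≤ p) (h' : p + 2 ≤ r) {Q : Set ℕ}
    (hQ : ∀ k ∈ Q, Far p k) {x z : BraidMonoid e r} (hx : x ∈ supported Q)
    (hy : S e r p ∣ x * z) : S e r p ∣ z := by
  obtain ⟨y, hy⟩ := hy
  obtain ⟨w, rfl, -⟩ := S_eq_mul_of_far he h h' hQ hx hy.symm
  exact ⟨w, rfl⟩

theorem S_succ_dvd_S_mul (he : 2 ≤ e) {p : ℕ} (h : 1 ≤ p) (h' : p + 3 ≤ r) {z : BraidMonoid e r}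
    (hz : S e r (p + 1) ∣ S e r p * z) : S e r (p + 1) * S e r p ∣ z := by
  obtain ⟨a, ha, ha'⟩ := S_eq_gen (e := e) h (by omega : p + 2 ≤ r)
  obtain ⟨b, hb, hb'⟩ := S_eq_gen (e := e) (p := p + 1) (by omega) h'
  rw [ha', hb'] at hz ⊢
  exact dvd_of_adj he (by rw [ha, hb]; right; rfl) hz

theorem S_one_dvd_T_mul (he : 2 ≤ e) (h : 3 ≤ r) {i : ZMod e} {z : BraidMonoid e r}
    (hz : S e r 1 ∣ T r i * z) : S e r 1 * T r i ∣ z := by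
  obtain ⟨b, hb, hb'⟩ := S_eq_gen (e := e) le_rfl h
  rw [hb'] at hz ⊢
  exact dvd_of_adj he (by rw [hb]; right; rfl) hz

theorem T_dvd_S_one_mul (he : 2 ≤ e) (h : 3 ≤ r) {i : ZMod e} {z : BraidMonoid e r}
    (hz : T r i ∣ S e r 1 * z) : T r i * S e r 1 ∣ z := by
  obtain ⟨b, hb, hb'⟩ := S_eq_gen (e := e) le_rfl h
  rw [hb'] at hz ⊢
  exact dvd_of_adj he (by rw [hb]; left; rfl) hz

theorem tau_dvd (he : 2 ≤ e) {z : BraidMonoid e r} (h : ∀ i, T r i ∣ z) : tau e r ∣ z := by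
  have : Fact (1 < e) := ⟨he⟩
  obtain ⟨w, rfl⟩ := h 1
  exact mul_dvd_mul_left _ (dvd_of_circle he (by simp) (h 0))

/-- `tau` can be written to begin with any `t i`, so the hypothesis yields one divisibility for each
`i`. Together they make every `t i` divide what follows `S e r 1` in `z`, hence so does their lcm
`tau`. -/
theorem S_one_mul_tau_mul_S_one_dvd (he : 2 ≤ e) (h : 3 ≤ r) {z : BraidMonoid e r}
    (hz : S e r 1 ∣ tau e r * z) : S e r 1 * (tau e r * S e r 1) ∣ z := by
  have h1 (i : ZMod e) : S e r 1 * T r i ∣ T r (i - 1) * z :=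
    S_one_dvd_T_mul he h (by rwa [tau_eq i, mul_assoc] at hz)
  have h2 (i : ZMod e) : S e r 1 * T r i ∣ z := by
    have := S_one_dvd_T_mul he h ((Dvd.intro _ rfl).trans (h1 (i + 1)))
    rwa [add_sub_cancel_right] at this
  obtain ⟨w, rfl⟩ : S e r 1 ∣ z := (Dvd.intro _ rfl).trans (h2 0)
  obtain ⟨v, rfl⟩ := tau_dvd he fun i => dvd_of_mul_dvd_mul he _ (h2 i)
  refine mul_dvd_mul_left _ (mul_dvd_mul_left _ ?_)
  have h3 := h1 1
  -- Starting `tau` with `t 0` lets the braid relation expose `S e r 1` for cancellation; comparing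
  -- `t 1` with the distinct `t 0` then gives the last factor.
  rw [tau_eq (1 - 1), mul_assoc, T_braid_assoc h] at h3
  have : Fact (1 < e) := ⟨he⟩
  have h4 := dvd_of_circle he (by simp) (dvd_of_mul_dvd_mul he _ h3)
  exact dvd_of_mul_dvd_mul he _ (T_dvd_S_one_mul he h h4)

/-- If `s` is the generator of rank `m + 1` then the lcm of `s` and `lam m` is
`lam m * s * lam m * s`. -/
theorem lam_succ_dvd (he : 2 ≤ e) {m : ℕ} (h : m + 3 ≤ r) {z : BraidMonoid e r}
    (hz : S e r (m + 1) ∣ lam e r m * z) : lam e r (m + 1) ∣ z := by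
  induction m generalizing z with
  | zero => exact S_one_mul_tau_mul_S_one_dvd he h hz
  | succ k ih =>
    have far (q : ℕ) (hq : q ∈ Set.Iic k) : Far (k + 1 + 1) q := by
      rw [Set.mem_Iic] at hq; right; omega
    have mem : lam e r k ∈ supported (Set.Iic k) := lam_mem fun _ hq => hq
    rw [lam, mul_assoc, mul_assoc] at hz
    have hz := S_succ_dvd_S_mul he (by omega) (by omega) hz
    have h1 := S_dvd_of_far he (by omega) (by omega) far mem ((Dvd.intro _ rfl).trans hz)
    obtain ⟨z1, rfl⟩ := S_succ_dvd_S_mul he (by omega) (by omega) h1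
    -- With `a`, `b` of ranks `k + 2`, `k + 1`, here `z = a * b * z1`; the braid relation moves `a`
    -- to the front, where it cancels, leaving the hypothesis one rank lower.
    rw [mul_assoc, S_braid_assoc (by omega) (by omega), ← S_far_lam_assoc (by omega)] at hz
    have h2 := ih (by omega) (dvd_of_mul_dvd_mul he _ hz)
    obtain ⟨y, hy⟩ := dvd_of_mul_dvd_mul he _ h2
    rw [mul_assoc] at hy
    obtain ⟨w, hw, -⟩ := S_eq_mul_of_far he (by omega) (by omega) far mem hy
    obtain ⟨v, rfl⟩ := S_succ_dvd_S_mul he (by omega) (by omega) (Dvd.intro _ hw.symm)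
    rw [mul_assoc, S_braid_assoc (by omega) (by omega), ← S_far_lam_assoc (by omega)] at hy
    rw [mul_cancel he _ hy]
    exact ⟨v, by rw [lam, lam]; simp only [mul_assoc]⟩

/-- The last factor of `Delta (m + 1)` can be moved to the front, where `lam_succ_dvd` applies. The
new generator commutes with the remaining factor, so its two occurrences in `lam` are peeled off
around an instance of the induction hypothesis. -/
theorem lam_dvd_of_S_dvd_Delta_mul (he : 2 ≤ e) {m : ℕ} (h : m + 3 ≤ r) {u : BraidMonoid e r}
    (hu : S e r (m + 1) ∣ Delta e r (m + 1) * u) : lam e r (m + 1) ∣ u := by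
  induction m generalizing u with
  | zero => exact lam_succ_dvd he h (by simpa [Delta] using hu)
  | succ m ih =>
    rw [Delta, Delta_mul_lam (by omega), mul_assoc] at hu
    obtain ⟨v, hv⟩ := lam_succ_dvd he (by omega) hu
    rw [lam, mul_assoc, mul_assoc] at hv
    obtain ⟨u, rfl, hu'⟩ := S_eq_mul_of_far he (by omega) (by omega) (Q := Set.Iio (m + 1))
      (fun k hk => by rw [Set.mem_Iio] at hk; right; omega) (Delta_mem fun _ hk => hk) hv.symm
    obtain ⟨u, rfl⟩ := ih (by omega) (by
      rw [← hu', lam, mul_assoc]; exact Dvd.intro _ rfl)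
    rw [← mul_assoc (Delta _ _ _), Delta_mul_lam (by omega), mul_assoc] at hu'
    obtain ⟨w, rfl, -⟩ := S_eq_mul_of_far he (by omega) (by omega) (Q := Set.Iio (m + 1))
      (fun k hk => by rw [Set.mem_Iio] at hk; right; omega) (Delta_mem fun _ hk => hk)
      (mul_cancel he _ hu')
    exact ⟨w, by rw [lam.eq_def _ _ (m + 1 + 1)]; simp only [mul_assoc]⟩

/-- `Delta m` is the lcm of the generators of rank less than `m`. -/
theorem Delta_dvd (he : 2 ≤ e) {m : ℕ} (h : m + 1 ≤ r) {w : BraidMonoid e r}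
    (hw : ∀ a : Gen e r, a.rank < m → gen a ∣ w) : Delta e r m ∣ w := by
  induction m with
  | zero => exact one_dvd _
  | succ m ih =>
    rcases m with _ | m
    · rw [Delta, Delta, one_mul]
      exact tau_dvd he fun i => hw _ (by simp)
    · obtain ⟨u, rfl⟩ := ih (by omega) fun a ha => hw a (by omega)
      obtain ⟨a, ha, ha'⟩ := S_eq_gen (e := e) (p := m + 1) (by omega) h
      refine mul_dvd_mul_left _ (lam_dvd_of_S_dvd_Delta_mul he (by omega) ?_)
      rw [ha']
      exact hw a (by omega)

theorem gen_dvd_Delta {m : ℕ} (h : m + 1 ≤ r) {a : Gen e r} (ha : a.rank < m) :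
    gen a ∣ Delta e r m := by
  induction m with
  | zero => omega
  | succ m ih =>
    by_cases ham : a.rank < m
    · exact (ih (by omega) ham).trans (Dvd.intro _ rfl)
    · rw [Delta, Delta_mul_lam (by omega)]
      refine Dvd.dvd.mul_right ?_ _
      rcases m with _ | m
      · rcases a with i | j
        · rw [lam, tau_eq i]; exact Dvd.intro _ rfl
        · have := j.2.1; simp only [Gen.rank] at ha; omega
      · rw [gen_eq_S (by omega), show a.rank = m + 1 by omega]
        exact Dvd.intro _ rfl

/-! ### The divisors of `lam m` -/

/-- The product of the generators of ranks `j + i, …, j + 1`. -/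
def descend (e r j : ℕ) : ℕ → BraidMonoid e r
  | 0 => 1
  | i + 1 => S e r (j + i + 1) * descend e r j i

/-- The product of the generators of ranks `j + 1, …, j + i`. -/
def ascend (e r j : ℕ) : ℕ → BraidMonoid e r
  | 0 => 1
  | i + 1 => ascend e r j i * S e r (j + i + 1)

theorem descend_succ' (j i : ℕ) :
    descend e r j (i + 1) = descend e r (j + 1) i * S e r (j + 1) := by
  induction i with
  | zero => simp [descend]
  | succ i ih =>
    rw [descend, ih, descend, mul_assoc, show j + 1 + i + 1 = j + (i + 1) + 1 by ring]

theorem ascend_succ' (j i : ℕ) :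
    ascend e r j (i + 1) = S e r (j + 1) * ascend e r (j + 1) i := by
  induction i with
  | zero => simp [ascend]
  | succ i ih =>
    rw [ascend, ih, ascend, mul_assoc, show j + 1 + i + 1 = j + (i + 1) + 1 by ring]

theorem descend_mem {Q : Set ℕ} {j i : ℕ} (h : ∀ k, j < k → k ≤ j + i → k ∈ Q) :
    descend e r j i ∈ supported Q := by
  induction i with
  | zero => exact one_mem _
  | succ i ih =>
    exact mul_mem (S_mem (h _ (by omega) (by omega))) (ih fun k hk hk' => h k hk (by omega))

theorem ascend_mem {Q : Set ℕ} {j i : ℕ} (h : ∀ k, j < k → k ≤ j + i → k ∈ Q) :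
    ascend e r j i ∈ supported Q := by
  induction i with
  | zero => exact one_mem _
  | succ i ih =>
    exact mul_mem (ih fun k hk hk' => h k hk (by omega)) (S_mem (h _ (by omega) (by omega)))

theorem lam_add (j i : ℕ) :
    lam e r (j + i) = descend e r j i * (lam e r j * ascend e r j i) := by
  induction i with
  | zero => simp [descend, ascend]
  | succ i ih =>
    rw [← add_assoc, lam, ih, descend, ascend]
    simp only [mul_assoc]

theorem ascend_add (j i k : ℕ) :
    ascend e r j (i + k) = ascend e r j i * ascend e r (j + i) k := by
  induction k with
  | zero => simp [ascend]
  | succ k ih => rw [← add_assoc, ascend, ih, ascend, mul_assoc, add_assoc j i k]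

/-- If `gen a` divided, it would have to be followed by the generator of the next rank, and `y`
would absorb `gen a`. The same question arises one rank higher, until a letter would divide an
element supported on strictly lower ranks. -/
theorem not_gen_dvd_ascend_mul (he : 2 ≤ e) {a : Gen e r} {i : ℕ} (h : a.rank + i + 2 ≤ r)
    {y : BraidMonoid e r} (hy : y ∈ supported (Set.Iio (a.rank + i))) :
    ¬ gen a ∣ ascend e r a.rank i * y := by
  induction i generalizing a y with
  | zero =>
    rintro ⟨z, hz⟩
    rw [ascend, one_mul] at hz
    subst hz
    rw [mul_mem_supported, gen_mem_supported, Set.mem_Iio] at hy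
    omega
  | succ i ih =>
    intro hd
    obtain ⟨b, hb, hb'⟩ := S_eq_gen (e := e) (r := r) (p := a.rank + 1) (by omega) (by omega)
    rw [ascend_succ', hb', mul_assoc] at hd
    obtain ⟨z, hz⟩ := dvd_of_adj he (by rw [hb]; left; rfl) hd
    have mem : ascend e r (a.rank + 1) i ∈ supported {k | Far a.rank k} :=
      ascend_mem fun k hk _ => by left; omega
    rw [mul_assoc] at hz
    obtain ⟨y, rfl, hy'⟩ := eq_mul_of_far he (fun _ hk => hk) mem hz.symm
    rw [mul_mem_supported] at hy
    rw [← hb] at hy'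
    refine ih (a := b) (by omega) (supported_mono ?_ hy.2) ⟨z, hy'.symm⟩
    intro k hk
    rw [Set.mem_Iio] at *
    omega

theorem not_S_dvd_lam_mul_ascend_mul (he : 2 ≤ e) {j i : ℕ} (h : j + i + 3 ≤ r)
    {y : BraidMonoid e r} (hy : y ∈ supported (Set.Iio (j + i + 1))) :
    ¬ S e r (j + 1) ∣ lam e r j * (ascend e r j (i + 1) * y) := by
  intro hd
  obtain ⟨w, hw⟩ := lam_succ_dvd he (by omega) hd
  rw [ascend_succ', lam, mul_assoc, mul_assoc, mul_assoc] at hw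
  obtain ⟨y', rfl, hy'⟩ := eq_mul_of_far_supported he (Q := Set.Iic j) (Q' := Set.Ioi (j + 1))
    (fun p hp q hq => by rw [Set.mem_Iic] at hp; rw [Set.mem_Ioi] at hq; left; omega)
    (lam_mem fun _ hk => hk) (ascend_mem fun _ hk _ => hk) (mul_cancel he _ hw).symm
  obtain ⟨b, hb, hb'⟩ := S_eq_gen (e := e) (r := r) (p := j + 1) (by omega) (by omega)
  rw [mul_mem_supported] at hy
  rw [hb'] at hy'
  refine not_gen_dvd_ascend_mul he (a := b) (i := i) (by omega) (supported_mono ?_ hy.2)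
    ⟨w, by rw [hb, hy']⟩
  intro k hk
  rw [Set.mem_Iio] at *
  omega

/-- A divisor `gen a` slips past the outer descending letters until it meets the generator of the
next rank. The adjacency rule, applied twice, then forces a letter of rank at most `a.rank` to
divide an ascending product of ranks at least `a.rank + 2`. -/
theorem isReduced_lam (he : 2 ≤ e) {m : ℕ} (h : m + 2 ≤ r) : IsReduced m (lam e r m) := by
  intro a ha hd
  obtain ⟨i, rfl⟩ : ∃ i, m = a.rank + 1 + i := ⟨m - (a.rank + 1), by omega⟩
  rw [lam_add] at hd
  have hd := dvd_of_far he (Q := {k | Far a.rank k}) (fun _ hk => hk)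
    (descend_mem fun k hk _ => by left; omega) hd
  obtain ⟨b, hb, hb'⟩ := S_eq_gen (e := e) (r := r) (p := a.rank + 1) (by omega) (by omega)
  rw [lam, mul_assoc, hb'] at hd
  have hd := dvd_of_adj he (by rw [hb]; left; rfl) hd
  rw [← hb', mul_assoc, ← ascend_succ'] at hd
  rcases Nat.eq_zero_or_pos a.rank with h0 | h0
  · rcases a with i | j
    · rw [rank_t, lam, tau_eq i, mul_assoc] at hd
      have hd := S_one_dvd_T_mul he (by omega) (dvd_of_mul_dvd_mul he _ hd)
      rw [ascend_succ'] at hd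
      have hd := dvd_of_mul_dvd_mul he _ hd
      exact not_gen_dvd_one _ (dvd_of_far he (a := .t (i - 1)) (Q := {k | Far 0 k})
        (fun _ hk => hk) (ascend_mem fun k hk _ => by left; omega) (by rwa [mul_one]))
    · have := j.2.1; simp only [Gen.rank] at h0; omega
  · obtain ⟨p, hp⟩ : ∃ p, a.rank = p + 1 := ⟨a.rank - 1, by omega⟩
    rw [gen_eq_S h0, hp, lam, mul_assoc] at hd
    have hd := dvd_of_mul_dvd_mul he _ hd
    rw [mul_assoc] at hd
    have hd := S_dvd_of_far he (Q := Set.Iic p) (by omega) (by omega)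
      (fun k hk => by rw [Set.mem_Iic] at hk; right; omega) (lam_mem fun _ hk => hk) hd
    have hd := S_succ_dvd_S_mul he (by omega) (by omega) hd
    rw [ascend_succ'] at hd
    have hd := dvd_of_mul_dvd_mul he _ hd
    rw [← hp, ← gen_eq_S h0] at hd
    exact not_gen_dvd_one _ (dvd_of_far he (Q := {k | Far a.rank k})
        (fun _ hk => hk) (ascend_mem fun k hk _ => by left; omega) (by rwa [mul_one]))

theorem S_mul_descend {p j i : ℕ} (hp : 1 ≤ p) (hj : j < p) (h : p < j + i) (hr : j + i + 2 ≤ r) :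
    S e r p * descend e r j i = descend e r j i * S e r (p + 1) := by
  induction i with
  | zero => omega
  | succ i ih =>
    rw [descend]
    rcases Nat.lt_or_ge p (j + i) with hlt | hge
    · rw [← mul_assoc, S_far_S (by omega), mul_assoc, ih hlt (by omega), mul_assoc]
    · obtain ⟨i, rfl⟩ : ∃ k, i = k + 1 := ⟨i - 1, by omega⟩
      obtain rfl : p = j + i + 1 := by omega
      have far : S e r (j + (i + 1) + 1) * descend e r j i =
          descend e r j i * S e r (j + (i + 1) + 1) :=
        S_comm (Q := Set.Iic (j + i)) (fun k hk => by rw [Set.mem_Iic] at hk; right; omega)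
          (descend_mem fun k _ hk => hk)
      rw [descend, mul_assoc, mul_assoc, ← add_assoc] at *
      rw [← far, S_braid_assoc hp (by omega)]

theorem descend_add (j i k : ℕ) :
    descend e r j (i + k) = descend e r (j + i) k * descend e r j i := by
  induction k with
  | zero => simp [descend]
  | succ k ih => rw [← add_assoc, descend, ih, descend, mul_assoc, add_assoc j i k]

/-- The left divisors of `lam m`. They are the reduced representatives of the simples modulo the
elements with letters of rank less than `m`. -/
inductive IsCosetRep (e r m : ℕ) : BraidMonoid e r → Prop
  | low (j i : ℕ) (h : j + i = m) : IsCosetRep e r m (descend e r j i)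
  | mid (i : ZMod e) : IsCosetRep e r m (descend e r 0 m * T r i)
  | high (j : ℕ) (h : j ≤ m) : IsCosetRep e r m (descend e r 0 m * (tau e r * ascend e r 0 j))

theorem lam_eq (m : ℕ) : lam e r m = descend e r 0 m * (tau e r * ascend e r 0 m) := by
  conv_lhs => rw [← zero_add m, lam_add, lam]

theorem IsCosetRep.dvd_lam {m : ℕ} {c : BraidMonoid e r} (h : IsCosetRep e r m c) :
    c ∣ lam e r m := by
  rcases h with ⟨j, i, rfl⟩ | ⟨i⟩ | ⟨j, h⟩
  · rw [lam_add]; exact Dvd.intro _ rfl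
  · rw [lam_eq, tau_eq i, mul_assoc]
    exact mul_dvd_mul_left _ (Dvd.intro _ rfl)
  · obtain ⟨i, rfl⟩ := Nat.exists_eq_add_of_le h
    rw [lam_eq, ascend_add 0 j]
    exact mul_dvd_mul_left _ (mul_dvd_mul_left _ (Dvd.intro _ rfl))

theorem IsCosetRep.isReduced (he : 2 ≤ e) {m : ℕ} (h : m + 2 ≤ r) {c : BraidMonoid e r}
    (hc : IsCosetRep e r m c) : IsReduced m c :=
  fun a ha hd => isReduced_lam he h a ha (hd.trans hc.dvd_lam)

/-- A right multiple `c * gen a` of a coset representative is again a coset representative, or of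
the form `gen b * c`, or it divides no `lam m * y`. -/
def MulGenCases (m : ℕ) (c : BraidMonoid e r) (a : Gen e r) : Prop :=
  IsCosetRep e r m (c * gen a) ∨ (∃ b : Gen e r, b.rank < m ∧ c * gen a = gen b * c) ∨
    ∀ y ∈ supported (Set.Iio m), ¬ c * gen a ∣ lam e r m * y

theorem descend_mul_S {m p : ℕ} (hp : 2 ≤ p) (hpm : p ≤ m) (hr : m + 2 ≤ r) {j i : ℕ}
    (hm : j + i = m) (hj : j + 1 < p) :
    ∃ b : Gen e r, b.rank < m ∧ descend e r j i * S e r p = gen b * descend e r j i := by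
  obtain ⟨q, rfl⟩ : ∃ q, p = q + 1 := ⟨p - 1, by omega⟩
  obtain ⟨b, hb, hb'⟩ := S_eq_gen (e := e) (r := r) (p := q) (by omega) (by omega)
  exact ⟨b, by omega, by rw [← hb', S_mul_descend (by omega) (by omega) (by omega) (by omega)]⟩

theorem mulGenCases_descend (he : 2 ≤ e) {m j i : ℕ} (h : m + 2 ≤ r) (hm : j + i = m)
    {a : Gen e r} (ha : a.rank ≤ m) : MulGenCases m (descend e r j i) a := by
  rcases lt_trichotomy a.rank j with hlt | heq | hgt
  · refine .inr (.inl ⟨a, by omega, ?_⟩)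
    exact (gen_comm_of_far (Q := {k | Far a.rank k}) (fun _ hk => hk)
      (descend_mem fun k hk _ => by left; omega)).symm
  · left
    rcases j with _ | j
    · rcases a with k | k
      · obtain rfl : i = m := by omega
        exact .mid k
      · have := k.2.1; simp only [Gen.rank] at heq; omega
    · rw [gen_eq_S (by omega), heq, ← descend_succ']
      exact .low _ _ (by omega)
  · rw [MulGenCases, gen_eq_S (by omega)]
    rcases Nat.lt_or_ge (j + 1) a.rank with hlt | hge
    · exact .inr (.inl (descend_mul_S (by omega) ha h hm hlt))
    · refine .inr (.inr fun y hy hd => ?_)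
      have hj : a.rank = j + 1 := by omega
      obtain ⟨i, rfl⟩ : ∃ k, i = k + 1 := ⟨i - 1, by omega⟩
      rw [hj, ← hm, lam_add, mul_assoc] at hd
      have hd := dvd_of_mul_dvd_mul he _ hd
      rw [mul_assoc] at hd
      exact not_S_dvd_lam_mul_ascend_mul he (by omega) (by rwa [add_assoc, hm]) hd

theorem mulGenCases_mid (he : 2 ≤ e) {m : ℕ} (h : m + 2 ≤ r) (i : ZMod e)
    {a : Gen e r} (ha : a.rank ≤ m) : MulGenCases m (descend e r 0 m * T r i) a := by
  rcases Nat.eq_zero_or_pos a.rank with h0 | h0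
  · rcases a with k | k
    · by_cases hk : k = i - 1
      · left
        subst hk
        have := IsCosetRep.high (e := e) (r := r) (m := m) 0 (Nat.zero_le _)
        rwa [ascend, mul_one, tau_eq i, ← mul_assoc] at this
      · refine .inr (.inr fun y hy hd => ?_)
        rw [lam_eq, mul_assoc, mul_assoc] at hd
        have hd := dvd_of_mul_dvd_mul he _ hd
        rw [tau_eq i, mul_assoc, mul_assoc] at hd
        -- Once `t i` is cancelled, `t k` and the distinct `t (i - 1)` have `tau` as lcm, so `t (i -
        -- 2)` would divide the ascending tail.
        have hd := dvd_of_circle he hk (dvd_of_mul_dvd_mul he _ hd)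
        exact not_gen_dvd_ascend_mul he (a := .t (i - 1 - 1)) (i := m) (by rw [rank_t]; omega)
          (by rwa [rank_t, zero_add]) hd
    · have := k.2.1; simp only [Gen.rank] at h0; omega
  · refine .inr (.inl ?_)
    rw [gen_eq_S h0]
    rcases Nat.lt_or_ge a.rank 2 with h2 | h2
    · have h1 : a.rank = 1 := by omega
      obtain ⟨m, rfl⟩ : ∃ k, m = k + 1 := ⟨m - 1, by omega⟩
      -- The braid relation turns `s 3 * t i * s 3` into `t i * s 3 * t i`, and the leading `t i`
      -- commutes with the remaining descending letters.
      refine ⟨.t i, by rw [rank_t]; omega, ?_⟩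
      have hT : T r i * descend e r 1 m = descend e r 1 m * T r i :=
        gen_comm_of_far (a := .t i) (Q := {k | Far 0 k}) (fun _ hk => hk)
          (descend_mem fun k hk _ => by left; omega)
      rw [h1, descend_succ', zero_add, ← mul_assoc, ← mul_assoc, hT]
      simp only [mul_assoc]
      rw [T_braid (by omega)]
    · obtain ⟨b, hb, hb'⟩ := descend_mul_S (e := e) h2 ha h (zero_add m) (by omega)
      exact ⟨b, hb, by rw [mul_assoc, ← S_far_T h2, ← mul_assoc, hb', mul_assoc]⟩

theorem mulGenCases_high (he : 2 ≤ e) {m j : ℕ} (h : m + 2 ≤ r) (hj : j ≤ m)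
    {a : Gen e r} (ha : a.rank ≤ m) :
    MulGenCases m (descend e r 0 m * (tau e r * ascend e r 0 j)) a := by
  obtain ⟨i, rfl⟩ := Nat.exists_eq_add_of_le hj
  rcases lt_trichotomy a.rank j with hlt | heq | hgt
  · have hrank (k : ZMod e) : (a.shift k).rank = a.rank := by rcases a with i | j <;> rfl
    -- The representative ends in `lam j`, which rotates by `-1` a letter crossing it from left to
    -- right; `shift 1` compensates.
    refine .inr (.inl ⟨a.shift 1, by rw [hrank]; omega, ?_⟩)
    have hc : descend e r 0 (j + i) * (tau e r * ascend e r 0 j) =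
        descend e r j i * lam e r j := by
      rw [descend_add, zero_add, mul_assoc, lam_eq]
    have hl := mul_lam (m := j) (by omega) (y := gen (a.shift 1))
      (gen_mem_supported.2 (by rw [hrank]; exact hlt))
    have hs : shift (-1) (gen (a.shift 1)) = gen a := by
      rw [shift_gen]
      rcases a with i | j <;> simp [Gen.shift]
    rw [hs] at hl
    rw [hc, mul_assoc, ← hl, ← mul_assoc, ← mul_assoc]
    congr 1
    exact (gen_comm_of_far (Q := {k | Far (a.shift 1).rank k}) (fun _ hk => hk)
      (descend_mem fun k hk _ => by left; rw [hrank]; omega)).symm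
  · refine .inr (.inr fun y hy hd => ?_)
    rw [lam_eq, ascend_add] at hd
    simp only [mul_assoc] at hd
    have hd := dvd_of_mul_dvd_mul he _ hd
    have hd := dvd_of_mul_dvd_mul he _ (dvd_of_mul_dvd_mul he _ hd)
    rw [zero_add, ← heq] at hd
    exact not_gen_dvd_ascend_mul he (i := i) (by omega) (by rwa [heq]) hd
  · rw [MulGenCases, gen_eq_S (by omega)]
    rcases Nat.lt_or_ge (j + 1) a.rank with hlt | hge
    · refine .inr (.inl ?_)
      obtain ⟨b, hb, hb'⟩ := descend_mul_S (e := e) (by omega) ha h (zero_add _) (by omega)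
      refine ⟨b, hb, ?_⟩
      have mem : tau e r * ascend e r 0 j ∈ supported (Set.Iic j) :=
        mul_mem (tau_mem (Nat.zero_le _)) (ascend_mem fun k _ hk => by
          rw [Set.mem_Iic]; omega)
      rw [mul_assoc, ← S_comm (fun k hk => by rw [Set.mem_Iic] at hk; right; omega) mem,
        ← mul_assoc, hb', mul_assoc]
    · left
      have hj : a.rank = 0 + j + 1 := by omega
      rw [hj, mul_assoc, mul_assoc, ← ascend]
      exact .high _ (by omega)

theorem IsCosetRep.mulGenCases (he : 2 ≤ e) {m : ℕ} (h : m + 2 ≤ r) {c : BraidMonoid e r}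
    (hc : IsCosetRep e r m c) {a : Gen e r} (ha : a.rank ≤ m) : MulGenCases m c a := by
  rcases hc with ⟨j, i, hm⟩ | ⟨i⟩ | ⟨j, hj⟩
  · exact mulGenCases_descend he h hm ha
  · exact mulGenCases_mid he h i ha
  · exact mulGenCases_high he h hj ha

/-- The divisor is built by appending letters on the right; `MulGenCases` says whether the letter
extends the representative, crosses it into the parabolic part, or is impossible. -/
theorem exists_of_dvd_Delta_succ (he : 2 ≤ e) {m : ℕ} (h : m + 2 ≤ r) {w : BraidMonoid e r}
    (hw : w ∣ Delta e r (m + 1)) :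
    ∃ x c, x ∣ Delta e r m ∧ IsCosetRep e r m c ∧ w = x * c := by
  have memD : Delta e r m ∈ supported (Set.Iio m) := Delta_mem fun _ hk => hk
  induction w using mul_gen_induction with
  | one => exact ⟨1, 1, one_dvd _, .low m 0 rfl, (one_mul _).symm⟩
  | mul_gen w a ih =>
    obtain ⟨x, c, hx, hc, rfl⟩ := ih ((Dvd.intro _ rfl).trans hw)
    have memx : x ∈ supported (Set.Iio m) := by
      obtain ⟨y, hy⟩ := hx
      rw [hy, mul_mem_supported] at memD
      exact memD.1
    have ha : a.rank < m + 1 := by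
      obtain ⟨y, hy⟩ := hw
      have : Delta e r (m + 1) ∈ supported (Set.Iio (m + 1)) := Delta_mem fun _ hk => hk
      rw [hy, mul_mem_supported, mul_mem_supported, gen_mem_supported] at this
      exact this.1.2
    rcases hc.mulGenCases he h (Nat.lt_succ_iff.1 ha) with h1 | ⟨b, hb, h1⟩ | h1
    · exact ⟨x, c * gen a, hx, h1, mul_assoc _ _ _⟩
    · rw [mul_assoc, h1, ← mul_assoc] at hw ⊢
      -- Since `lam m` is reduced, a parabolic divisor of `Delta m * lam m` divides `Delta m`.
      exact ⟨x * gen b, c, dvd_of_dvd_mul_isReduced he memD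
        (mul_mem memx (gen_mem_supported.2 hb)) (isReduced_lam he h)
        ((Dvd.intro _ rfl).trans hw), hc, rfl⟩
    · obtain ⟨y, hy⟩ := hx
      rw [hy, mul_mem_supported] at memD
      rw [Delta, hy, mul_assoc, mul_assoc, mul_lam h memD.2] at hw
      exact absurd (dvd_of_mul_dvd_mul he _ hw) (h1 _ (shift_mem_supported _ memD.2))

theorem mul_dvd_Delta_succ {m : ℕ} (h : m + 2 ≤ r) {x c : BraidMonoid e r}
    (hx : x ∣ Delta e r m) (hc : c ∣ lam e r m) : x * c ∣ Delta e r (m + 1) := by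
  obtain ⟨y, hy⟩ := hx
  have memD : Delta e r m ∈ supported (Set.Iio m) := Delta_mem fun _ hk => hk
  rw [hy, mul_mem_supported] at memD
  rw [Delta, hy, mul_assoc, mul_lam h memD.2]
  exact mul_dvd_mul_left _ (hc.mul_right _)

/-! ### Counting the divisors -/

theorem length_S {p : ℕ} (h : 1 ≤ p) (h' : p + 2 ≤ r) : length (S e r p) = 1 := by
  obtain ⟨a, -, ha⟩ := S_eq_gen (e := e) h h'
  rw [ha, length_gen]

theorem length_descend {j i : ℕ} (h : j + i + 2 ≤ r) : length (descend e r j i) = i := by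
  induction i with
  | zero => exact length_one
  | succ i ih => rw [descend, length_mul, ih (by omega), length_S (by omega) (by omega), add_comm]

theorem length_ascend {j i : ℕ} (h : j + i + 2 ≤ r) : length (ascend e r j i) = i := by
  induction i with
  | zero => exact length_one
  | succ i ih => rw [ascend, length_mul, ih (by omega), length_S (by omega) (by omega)]

theorem length_tau : length (tau e r) = 2 := by
  rw [tau, length_mul, length_gen, length_gen]

/-- Lengths separate all the representatives except the `e` of length `m + 1`, which left
cancellation and injectivity of `gen` tell apart. -/
theorem exists_finset_isCosetRep (he : 2 ≤ e) {m : ℕ} (h : m + 2 ≤ r) :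
    ∃ s : Finset (BraidMonoid e r), (∀ c, c ∈ s ↔ IsCosetRep e r m c) ∧
      ∑ c ∈ s, (X : ℕ[X]) ^ length c =
        (∑ i ∈ Finset.Icc 0 m, X ^ i) + C e * X ^ (m + 1) +
          ∑ i ∈ Finset.Icc (m + 2) (2 * m + 2), X ^ i := by
  classical
  have : NeZero e := ⟨by omega⟩
  let f (i : ℕ) : BraidMonoid e r := descend e r (m - i) i
  let g (i : ZMod e) : BraidMonoid e r := descend e r 0 m * T r i
  let k (j : ℕ) : BraidMonoid e r := descend e r 0 m * (tau e r * ascend e r 0 (j - (m + 2)))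
  have hf : ∀ i ∈ Finset.Icc 0 m, length (f i) = i := fun i hi => by
    rw [Finset.mem_Icc] at hi
    exact length_descend (by omega)
  have hg (i : ZMod e) : length (g i) = m + 1 := by
    rw [length_mul, length_descend (by omega), length_gen]
  have hk : ∀ j ∈ Finset.Icc (m + 2) (2 * m + 2), length (k j) = j := fun j hj => by
    rw [Finset.mem_Icc] at hj
    rw [length_mul, length_mul, length_descend (by omega), length_tau, length_ascend (by omega)]
    omega
  refine ⟨(Finset.Icc 0 m).image f ∪ Finset.univ.image g ∪
    (Finset.Icc (m + 2) (2 * m + 2)).image k, fun c => ?_, ?_⟩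
  · simp only [Finset.mem_union, Finset.mem_image, Finset.mem_univ, true_and, or_assoc]
    constructor
    · rintro (⟨i, hi, rfl⟩ | ⟨i, rfl⟩ | ⟨j, hj, rfl⟩)
      · rw [Finset.mem_Icc] at hi
        exact .low _ _ (by omega)
      · exact .mid i
      · rw [Finset.mem_Icc] at hj
        exact .high _ (by omega)
    · rintro (⟨j, i, hm⟩ | ⟨i⟩ | ⟨j, hj⟩)
      · exact .inl ⟨i, by rw [Finset.mem_Icc]; omega, by simp only [f]; congr 1; omega⟩
      · exact .inr (.inl ⟨i, rfl⟩)
      · exact .inr (.inr ⟨j + (m + 2), by rw [Finset.mem_Icc]; omega, by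
          simp only [k, Nat.add_sub_cancel]⟩)
  · rw [Finset.sum_union, Finset.sum_union, Finset.sum_image, Finset.sum_image, Finset.sum_image]
    · congr 1
      · congr 1
        · exact Finset.sum_congr rfl fun i hi => by rw [hf i hi]
        · simp only [hg, Finset.sum_const, Finset.card_univ, ZMod.card, nsmul_eq_mul]
          simp
      · exact Finset.sum_congr rfl fun i hi => by rw [hk i hi]
    · intro i hi j hj hij
      rw [← hk i hi, ← hk j hj, hij]
    · intro i _ j _ hij
      exact Gen.t.inj (gen_injective he (mul_cancel he _ hij))
    · intro i hi j hj hij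
      rw [← hf i hi, ← hf j hj, hij]
    · rw [Finset.disjoint_left]
      intro c hc hc'
      obtain ⟨i, hi, rfl⟩ := Finset.mem_image.1 hc
      obtain ⟨j, -, hij⟩ := Finset.mem_image.1 hc'
      have := hf i hi
      rw [← hij, hg] at this
      rw [Finset.mem_Icc] at hi
      omega
    · rw [Finset.disjoint_left]
      intro c hc hc'
      obtain ⟨j, hj, rfl⟩ := Finset.mem_image.1 hc'
      have hj' := hk j hj
      rw [Finset.mem_Icc] at hj
      rcases Finset.mem_union.1 hc with hc | hc
      · obtain ⟨i, hi, hij⟩ := Finset.mem_image.1 hc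
        rw [← hij, hf i hi] at hj'
        rw [Finset.mem_Icc] at hi
        omega
      · obtain ⟨i, -, hij⟩ := Finset.mem_image.1 hc
        rw [← hij, hg] at hj'
        omega

theorem exists_finset_dvd_Delta (he : 2 ≤ e) {m : ℕ} (h : m + 1 ≤ r) :
    ∃ s : Finset (BraidMonoid e r), (∀ x, x ∈ s ↔ x ∣ Delta e r m) ∧
      ∑ x ∈ s, (X : ℕ[X]) ^ length x =
        ∏ k ∈ Finset.range m, ((∑ i ∈ Finset.Icc 0 k, X ^ i) + C (e : ℕ) * X ^ (k + 1) +
          ∑ i ∈ Finset.Icc (k + 2) (2 * k + 2), X ^ i) := by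
  classical
  induction m with
  | zero =>
    refine ⟨{1}, fun x => ?_, by simp⟩
    rw [Finset.mem_singleton, Delta]
    refine ⟨fun hx => hx ▸ dvd_rfl, fun ⟨y, hy⟩ => eq_one_of_length_eq_zero ?_⟩
    have := congrArg length hy
    rw [length_one, length_mul] at this
    omega
  | succ m ih =>
    obtain ⟨s, hs, hs'⟩ := ih (by omega)
    obtain ⟨t, ht, ht'⟩ := exists_finset_isCosetRep (e := e) he h
    refine ⟨(s ×ˢ t).image fun p => p.1 * p.2, fun x => ?_, ?_⟩
    · simp only [Finset.mem_image, Finset.mem_product, hs, ht, Prod.exists]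
      constructor
      · rintro ⟨x, c, ⟨hx, hc⟩, rfl⟩
        exact mul_dvd_Delta_succ h hx hc.dvd_lam
      · intro hx
        obtain ⟨y, c, hy, hc, rfl⟩ := exists_of_dvd_Delta_succ he h hx
        exact ⟨y, c, ⟨hy, hc⟩, rfl⟩
    · rw [Finset.sum_image, Finset.sum_product, Finset.prod_range_succ, ← hs', ← ht',
        Finset.sum_mul_sum]
      · simp only [length_mul, pow_add]
      · have mem {x : BraidMonoid e r} (hx : x ∈ s) : x ∈ supported (Set.Iio m) := by
          obtain ⟨y, hy⟩ := (hs x).1 hx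
          have : Delta e r m ∈ supported (Set.Iio m) := Delta_mem fun _ hk => hk
          rw [hy, mul_mem_supported] at this
          exact this.1
        rintro ⟨x, c⟩ hx ⟨x', c'⟩ hx' hxx'
        simp only [Finset.coe_product, Set.mem_prod, Finset.mem_coe] at hx hx'
        obtain ⟨rfl, rfl⟩ := decomposition_unique he (mem hx.1) (mem hx'.1)
          (((ht _).1 hx.2).isReduced he h) (((ht _).1 hx'.2).isReduced he h) hxx'
        rfl

/-! ### The minimal Garside element -/

theorem mul_Delta {m : ℕ} (h : m + 1 ≤ r) {x : BraidMonoid e r}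
    (hx : x ∈ supported (Set.Iio m)) :
    x * Delta e r m = Delta e r m * shift (-((m : ZMod e) + 1)) x := by
  induction x using gen_induction with
  | one => simp
  | gen_mul a x ih =>
    rw [mul_mem_supported, gen_mem_supported] at hx
    rw [map_mul, mul_assoc, ih hx.2, ← mul_assoc, gen_mul_Delta h a hx.1, mul_assoc, shift_gen]

theorem rank_lt (hr : 2 ≤ r) (a : Gen e r) : a.rank < r - 1 := by
  rcases Nat.eq_zero_or_pos a.rank with h | h
  · omega
  · have := rank_add_two_le a h
    omega

theorem mem_supported_Iio (hr : 2 ≤ r) (x : BraidMonoid e r) :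
    x ∈ supported (Set.Iio (r - 1)) := by
  induction x using gen_induction with
  | one => exact one_mem _
  | gen_mul a x ih => exact mul_mem (gen_mem_supported.2 (rank_lt hr a)) ih

/-- A generator has length 1 and so is indecomposable: it belongs to every generating set, in
particular to the divisors of `D`. -/
theorem gen_dvd_of_isGarsideElement {D : BraidMonoid e r} (hD : IsGarsideElement D)
    (a : Gen e r) : gen a ∣ D := by
  suffices H : ∀ x ∈ Submonoid.closure {x : BraidMonoid e r | x ∣ D}, x = gen a → x ∣ D from
    H _ (by rw [hD.generates]; trivial) rfl
  intro x hx
  induction hx using Submonoid.closure_induction with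
  | mem x hx => exact fun _ => hx
  | one => exact fun _ => one_dvd _
  | mul x y _ _ ihx ihy =>
    intro h
    have hl := congrArg length h
    rw [length_mul, length_gen] at hl
    rcases Nat.eq_zero_or_pos (length x) with h0 | h0
    · rw [eq_one_of_length_eq_zero h0, one_mul] at h ⊢
      exact ihy h
    · rw [eq_one_of_length_eq_zero (x := y) (by omega), mul_one] at h ⊢
      exact ihx h

/-- Quasi-centrality gives `x * Delta = Delta * x'` with `x'` the rotated `x`; substitute `Delta = x
* y` on the right and cancel `x`. -/
theorem mul_shift_eq_Delta (he : 2 ≤ e) (hr : 2 ≤ r) {x y : BraidMonoid e r}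
    (h : Delta e r (r - 1) = x * y) :
    Delta e r (r - 1) = y * shift (-(((r - 1 : ℕ) : ZMod e) + 1)) x := by
  refine mul_cancel he x ?_
  rw [mul_Delta (by omega) (mem_supported_Iio hr x), ← mul_assoc, ← h]

theorem isGarsideElement_Delta (he : 2 ≤ e) (hr : 2 ≤ r) :
    IsGarsideElement (Delta e r (r - 1)) where
  balanced x := by
    constructor
    · rintro ⟨y, hy⟩
      set k : ZMod e := ((r - 1 : ℕ) : ZMod e) + 1
      -- Rotation fixes `Delta`; rotating by `k` beforehand undoes the rotation that `x` undergoes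
      -- on crossing it.
      have h := congrArg (shift k) hy
      rw [shift_Delta, map_mul] at h
      have hx : shift (-k) (shift k x) = x := by
        simpa only [neg_neg] using shift_shift_neg (-k) x
      refine ⟨shift k y, ?_⟩
      rw [mul_shift_eq_Delta he hr h, hx]
    · rintro ⟨y, hy⟩
      exact ⟨_, mul_shift_eq_Delta he hr hy⟩
  finite_divisors := by
    obtain ⟨s, hs, -⟩ := exists_finset_dvd_Delta (e := e) (r := r) (m := r - 1) he (by omega)
    exact s.finite_toSet.subset fun x hx => (hs x).2 hx
  generates := by
    rw [eq_top_iff]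
    intro x _
    induction x using gen_induction with
    | one => exact one_mem _
    | gen_mul a x ih =>
      exact mul_mem (Submonoid.subset_closure (gen_dvd_Delta (by omega) (rank_lt hr a)))
        (ih trivial)

theorem isMinimalGarsideElement_Delta (he : 2 ≤ e) (hr : 2 ≤ r) :
    IsMinimalGarsideElement (Delta e r (r - 1)) where
  isGarsideElement := isGarsideElement_Delta he hr
  dvd D hD := Delta_dvd he (by omega) fun a _ => gen_dvd_of_isGarsideElement hD a

theorem eq_of_dvd_of_dvd {x y : BraidMonoid e r} (h : x ∣ y) (h' : y ∣ x) : x = y := by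
  obtain ⟨z, rfl⟩ := h
  obtain ⟨w, hw⟩ := h'
  have := congrArg length hw
  simp only [length_mul] at this
  rw [eq_one_of_length_eq_zero (x := z) (by omega), mul_one]

theorem IsMinimalGarsideElement.eq_Delta (he : 2 ≤ e) (hr : 2 ≤ r) {D : BraidMonoid e r}
    (hD : IsMinimalGarsideElement D) : D = Delta e r (r - 1) :=
  eq_of_dvd_of_dvd (hD.dvd _ (isGarsideElement_Delta he hr))
    ((isMinimalGarsideElement_Delta he hr).dvd _ hD.isGarsideElement)

theorem mem_simples_iff (he : 2 ≤ e) (hr : 2 ≤ r) {x : BraidMonoid e r} :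
    x ∈ simples (BraidMonoid e r) ↔ x ∣ Delta e r (r - 1) :=
  ⟨fun ⟨_, hD, hx⟩ => hD.eq_Delta he hr ▸ hx, fun h => ⟨_, isMinimalGarsideElement_Delta he hr, h⟩⟩

theorem simplePolynomial_eq_sum (s : Finset (BraidMonoid e r))
    (hs : ∀ x, x ∈ s ↔ x ∈ simples (BraidMonoid e r)) :
    simplePolynomial e r = ∑ x ∈ s, X ^ length x := by
  classical
  have hn (n : ℕ) : numSimples e r n = (s.filter fun x => length x = n).card := by
    rw [numSimples, ← Set.ncard_coe_finset]
    congr 1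
    ext x
    simp [hs]
  rw [simplePolynomial, finsum_eq_sum_of_support_subset (s := s.image length),
    Finset.sum_comp (fun n => (X : ℕ[X]) ^ n) length]
  · refine Finset.sum_congr rfl fun n _ => ?_
    rw [hn, nsmul_eq_mul]
    simp
  · intro n h
    rw [Function.mem_support, hn] at h
    obtain ⟨x, hx⟩ : (s.filter fun x => length x = n).Nonempty := by
      rw [← Finset.card_pos, Nat.pos_iff_ne_zero]
      intro h0
      simp [h0] at h
    rw [Finset.mem_filter] at hx
    exact Finset.mem_coe.2 (Finset.mem_image.2 ⟨x, hx⟩)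

end CorranPicantin

/-! ### The generating polynomial of the simples -/

theorem corollary3p8 (e r : ℕ) (he : 2 ≤ e) (hr : 2 ≤ r) :
    (∃! Δ : CorranPicantin.BraidMonoid e r, CorranPicantin.IsMinimalGarsideElement Δ) ∧
    (CorranPicantin.simples (CorranPicantin.BraidMonoid e r)).Finite ∧
    CorranPicantin.simplePolynomial e r =
      ∏ k ∈ Finset.Icc 2 r,
        ((∑ i ∈ Finset.Icc 0 (k - 2), (X : ℕ[X]) ^ i) + C e * X ^ (k - 1) +
          ∑ i ∈ Finset.Icc k (2 * k - 2), X ^ i) := by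
  obtain ⟨s, hs, hsum⟩ := CorranPicantin.exists_finset_dvd_Delta (e := e) (r := r) (m := r - 1) he
    (by omega)
  have hs' (x) : x ∈ s ↔ x ∈ CorranPicantin.simples (CorranPicantin.BraidMonoid e r) := by
    rw [hs, CorranPicantin.mem_simples_iff he hr]
  refine ⟨⟨_, CorranPicantin.isMinimalGarsideElement_Delta he hr, fun D hD => hD.eq_Delta he hr⟩,
    s.finite_toSet.subset fun x hx => (hs' x).2 hx, ?_⟩
  -- The factor contributed by `lam k` is the one indexed by `k + 2` in the product.
  rw [CorranPicantin.simplePolynomial_eq_sum s hs', hsum, ← Finset.Ico_add_one_right_eq_Icc,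
    Finset.prod_Ico_eq_prod_range, show r + 1 - 2 = r - 1 by omega]
  refine Finset.prod_congr rfl fun k _ => ?_
  rw [show 2 + k - 2 = k by omega, show 2 + k - 1 = k + 1 by omega, add_comm 2 k,
    show 2 * (k + 2) - 2 = 2 * k + 2 by omega]
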